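/- Let $(M,g)$ be a spacetime of dimension $1+n$: a smooth (Hausdorff, second countable) manifold with a smooth Lorentzian metric of signature $(-,+,\dots,+)$ and Levi-Civita connection $\nabla$. Coordinates $(t,\mathbf q)\in\mathbb R\times\mathbb R^n$ on an open set $U\subseteq M$ are called doubly warped if in them $$ds^2=-b(\mathbf q)^2\,dt^2+a(t)^2\,g^\star_{\mu\nu}(\mathbf q)\,dq^\mu dq^\nu$$ with smooth $a,b>0$ and a smooth Riemannian metric $g^\star$, and warped (generalized Robertson–Walker) if moreover $b=1$. The spacetime is called doubly warped (resp. generalized Robertson–Walker) near a point if such coordinates exist on an open neighbourhood of that point. A smooth vector field $\xi$ on an open set $U$ is a conformal Killing vector, with smooth conformal function $\kappa$, if $\nabla_i\xi_j+\nabla_j\xi_i=2\kappa g_{ij}$; it is hypersurface orthogonal if near each point of $U$ one has $\xi_i=f\,\partial_i h$ with smooth functions $f,h$ and $dh\neq0$. For a timelike hypersurface orthogonal conformal Killing vector the associated 1-form $\alpha$ is the 1-form with $$\nabla_i\xi_j=\kappa g_{ij}+\alpha_i\xi_j-\xi_i\alpha_j,\qquad \alpha_k\xi^k=0 .$$ 1.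 For every $p\in M$, the spacetime is doubly warped near $p$ if and only if some open neighbourhood of $p$ carries a timelike hypersurface orthogonal conformal Killing vector whose associated 1-form $\alpha$ is closed, $d\alpha=0$. 2. For every $p\in M$, the spacetime is doubly warped near $p$ if and only if some open neighbourhood of $p$ carries a timelike hypersurface orthogonal conformal Killing vector $\xi$ with $\nabla\kappa$ parallel to $\xi$, i.e. $\partial_i\kappa=c\,\xi_i$ for a scalar function $c$. 3. If $U$ is an open set that carries doubly warped coordinates, then vectors as in 1 and as in 2 exist on all of $U$. 4. If $\xi$ is a timelike hypersurface orthogonal conformal Killing vector on an open set $U$, with conformal function $\kappa$, and the 1-form $\xi_i$ is closed, then $\nabla_i\xi_j=\kappa g_{ij}$ on $U$ (that is, $\alpha=0$), and the spacetime is generalized Robertson–Walker near each point of $U$ (with coordinates on a neighbourhood contained in $U$). -/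

import Mathlib

open Bundle Set VectorField
open scoped Manifold ContDiff

noncomputable section

namespace DoublyWarped

/-- The model space `ℝ^{1+n}` of a spacetime of dimension `1 + n`. -/
abbrev Model (n : ℕ) : Type := EuclideanSpace ℝ (Fin (n + 1))

/-- The space `ℝⁿ` of the spatial coordinates `q`. -/
abbrev Space (n : ℕ) : Type := EuclideanSpace ℝ (Fin n)

variable {n : ℕ} {M : Type*} [TopologicalSpace M] [ChartedSpace (Model n) M]

/-- Vector fields on `M` (no regularity imposed). -/
abbrev VField (n : ℕ) (M : Type*) [TopologicalSpace M] [ChartedSpace (Model n) M] : Type _ :=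
  (p : M) → TangentSpace (𝓡 (n + 1)) p

/-- Differential 1-forms on `M` (no regularity imposed). -/
abbrev OneForm (n : ℕ) (M : Type*) [TopologicalSpace M] [ChartedSpace (Model n) M] : Type _ :=
  (p : M) → (TangentSpace (𝓡 (n + 1)) p →L[ℝ] ℝ)

variable [IsManifold (𝓡 (n + 1)) ∞ M]

/-- The vector field `X` is smooth on the set `U`. -/
def SmoothFieldOn (X : VField n M) (U : Set M) : Prop :=
  ContMDiffOn (𝓡 (n + 1)) (𝓡 (n + 1)).tangent ∞
    (fun p ↦ (⟨p, X p⟩ : TangentBundle (𝓡 (n + 1)) M)) U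

/-- The vector field `X` is smooth at the point `p`. -/
def SmoothFieldAt (X : VField n M) (p : M) : Prop :=
  ContMDiffAt (𝓡 (n + 1)) (𝓡 (n + 1)).tangent ∞
    (fun x ↦ (⟨x, X x⟩ : TangentBundle (𝓡 (n + 1)) M)) p

/-- The real function `f` is smooth on the set `U`. -/
def SmoothFunOn (n : ℕ) {M : Type*} [TopologicalSpace M] [ChartedSpace (Model n) M]
    (f : M → ℝ) (U : Set M) : Prop :=
  ContMDiffOn (𝓡 (n + 1)) 𝓘(ℝ, ℝ) ∞ f U

/-- The differential of the real function `f`, as a 1-form. -/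
def diff (n : ℕ) {M : Type*} [TopologicalSpace M] [ChartedSpace (Model n) M]
    (f : M → ℝ) : OneForm n M :=
  fun p ↦ (mfderiv (𝓡 (n + 1)) 𝓘(ℝ, ℝ) f p : TangentSpace (𝓡 (n + 1)) p →L[ℝ] ℝ)

/-- The Lie bracket `[X, Y]` of vector fields. -/
def bracket (X Y : VField n M) : VField n M := mlieBracket (𝓡 (n + 1)) X Y

/-- The 1-form `α` is smooth on the set `U`. -/
def SmoothFormOn (α : OneForm n M) (U : Set M) : Prop :=
  ContMDiffOn (𝓡 (n + 1)) ((𝓡 (n + 1)).prod 𝓘(ℝ, Model n →L[ℝ] ℝ)) ∞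
    (fun p ↦ TotalSpace.mk' (Model n →L[ℝ] ℝ)
      (E := fun p : M ↦ (TangentSpace (𝓡 (n + 1)) p →L[ℝ] ℝ)) p (α p)) U

/-- The exterior derivative of a 1-form, evaluated on two vector fields:
`dα(X, Y) = X(α(Y)) - Y(α(X)) - α([X, Y])`. -/
def extDer (α : OneForm n M) (X Y : VField n M) (p : M) : ℝ :=
  diff n (fun x ↦ α x (Y x)) p (X p) - diff n (fun x ↦ α x (X x)) p (Y p)
    - α p (bracket X Y p)

/-- The 1-form `α` is closed on `U`, i.e. `dα = 0` there. -/
def ClosedOn (α : OneForm n M) (U : Set M) : Prop :=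
  ∀ p ∈ U, ∀ X Y : VField n M, SmoothFieldAt X p → SmoothFieldAt Y p → extDer α X Y p = 0

/-- A smooth Lorentzian metric, of signature `(-, +, …, +)`: a smooth field of symmetric bilinear
forms on the tangent spaces, such that at each point there is a vector `v` with `g(v, v) < 0`
on whose orthogonal complement the form is positive definite. -/
structure LorentzianMetric (n : ℕ) (M : Type*) [TopologicalSpace M] [ChartedSpace (Model n) M]
    [IsManifold (𝓡 (n + 1)) ∞ M] where
  val (p : M) : TangentSpace (𝓡 (n + 1)) p →L[ℝ] TangentSpace (𝓡 (n + 1)) p →L[ℝ] ℝ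
  symm (p : M) (v w : TangentSpace (𝓡 (n + 1)) p) : val p v w = val p w v
  lorentzian (p : M) : ∃ v : TangentSpace (𝓡 (n + 1)) p, val p v v < 0 ∧
    ∀ w : TangentSpace (𝓡 (n + 1)) p, val p v w = 0 → w ≠ 0 → 0 < val p w w
  smooth : ContMDiff (𝓡 (n + 1)) ((𝓡 (n + 1)).prod 𝓘(ℝ, Model n →L[ℝ] Model n →L[ℝ] ℝ)) ∞
    (fun p ↦ TotalSpace.mk' (Model n →L[ℝ] Model n →L[ℝ] ℝ)
      (E := fun p : M ↦
        (TangentSpace (𝓡 (n + 1)) p →L[ℝ] TangentSpace (𝓡 (n + 1)) p →L[ℝ] ℝ)) p (val p))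

namespace LorentzianMetric

variable (g : LorentzianMetric n M)

/-- The function `g(X, Y)`. -/
def inn (X Y : VField n M) : M → ℝ := fun p ↦ g.val p (X p) (Y p)

/-- The 1-form `ξ_i = g_{ij} ξ^j` obtained by lowering the index of a vector field. -/
def flat (ξ : VField n M) : OneForm n M := fun p ↦ g.val p (ξ p)

/-- `g(∇_X ξ, Y) = X^i Y^j ∇_i ξ_j` for the Levi-Civita connection `∇` of `g`, given by the Koszul
formula. -/
def nabla (ξ X Y : VField n M) (p : M) : ℝ :=
  (diff n (g.inn ξ Y) p (X p) + diff n (g.inn X Y) p (ξ p) - diff n (g.inn X ξ) p (Y p)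
    + g.val p (bracket X ξ p) (Y p) - g.val p (bracket X Y p) (ξ p)
    - g.val p (bracket ξ Y p) (X p)) / 2

/-- The connection is compatible with the metric: `X g(Y, Z) = g(∇_X Y, Z) + g(Y, ∇_X Z)`. -/
theorem nabla_metric (X Y Z : VField n M) (p : M) :
    diff n (g.inn Y Z) p (X p) = g.nabla Y X Z p + g.nabla Z X Y p := by
  have hs : ∀ A B : VField n M, g.inn A B = g.inn B A := fun A B ↦
    funext fun q ↦ g.symm q (A q) (B q)
  have hb : bracket Y Z p = - bracket Z Y p := mlieBracket_swap_apply
  simp only [nabla, hs Z Y, hb, map_neg, neg_apply]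
  ring

/-- The connection is torsion free: `g(∇_X Y, Z) - g(∇_Y X, Z) = g([X, Y], Z)`. -/
theorem nabla_torsion_free (X Y Z : VField n M) (p : M) :
    g.nabla Y X Z p - g.nabla X Y Z p = g.val p (bracket X Y p) (Z p) := by
  have hs : g.inn X Y = g.inn Y X := funext fun q ↦ g.symm q (X q) (Y q)
  have hb : bracket Y X p = - bracket X Y p := mlieBracket_swap_apply
  simp only [nabla, hs, hb, map_neg, neg_apply]
  ring

/-- `ξ` is timelike on `U`. -/
def TimelikeOn (ξ : VField n M) (U : Set M) : Prop :=
  ∀ p ∈ U, g.val p (ξ p) (ξ p) < 0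

/-- `ξ` is a conformal Killing vector on `U`, with conformal function `κ`:
`∇_i ξ_j + ∇_j ξ_i = 2 κ g_{ij}`. -/
def ConformalKillingOn (ξ : VField n M) (κ : M → ℝ) (U : Set M) : Prop :=
  SmoothFieldOn ξ U ∧ SmoothFunOn n κ U ∧
    ∀ p ∈ U, ∀ X Y : VField n M, SmoothFieldAt X p → SmoothFieldAt Y p →
      g.nabla ξ X Y p + g.nabla ξ Y X p = 2 * κ p * g.val p (X p) (Y p)

/-- `ξ` is hypersurface orthogonal on `U`: near each point of `U` it is orthogonal to the level
hypersurfaces of a smooth function `h` with `dh ≠ 0`, i.e. `ξ_i = f ∂_i h`. -/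
def HypersurfaceOrthogonalOn (ξ : VField n M) (U : Set M) : Prop :=
  ∀ p ∈ U, ∃ V : Set M, IsOpen V ∧ p ∈ V ∧ V ⊆ U ∧ ∃ f h : M → ℝ,
    SmoothFunOn n f V ∧ SmoothFunOn n h V ∧
      ∀ x ∈ V, diff n h x ≠ 0 ∧ g.flat ξ x = f x • diff n h x

/-- `ξ` is a timelike hypersurface orthogonal conformal Killing vector on `U`, with conformal
function `κ`. -/
structure IsTHOCKV (ξ : VField n M) (κ : M → ℝ) (U : Set M) : Prop where
  timelike : g.TimelikeOn ξ U
  conformalKilling : g.ConformalKillingOn ξ κ U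
  hypersurfaceOrthogonal : g.HypersurfaceOrthogonalOn ξ U

/-- `α` is the 1-form associated on `U` with the conformal Killing vector `ξ`:
`∇_i ξ_j = κ g_{ij} + α_i ξ_j - ξ_i α_j` and `α_k ξ^k = 0`. -/
def AssociatedFormOn (ξ : VField n M) (κ : M → ℝ) (α : OneForm n M) (U : Set M) : Prop :=
  SmoothFormOn α U ∧ (∀ p ∈ U, α p (ξ p) = 0) ∧
    ∀ p ∈ U, ∀ X Y : VField n M, SmoothFieldAt X p → SmoothFieldAt Y p →
      g.nabla ξ X Y p = κ p * g.val p (X p) (Y p)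
        + α p (X p) * g.flat ξ p (Y p) - g.flat ξ p (X p) * α p (Y p)

/-- On `U` there is a timelike hypersurface orthogonal conformal Killing vector whose associated
1-form is closed. -/
def HasClosedTHOCKV (U : Set M) : Prop :=
  ∃ (ξ : VField n M) (κ : M → ℝ) (α : OneForm n M),
    g.IsTHOCKV ξ κ U ∧ g.AssociatedFormOn ξ κ α U ∧ ClosedOn α U

/-- On `U` there is a timelike hypersurface orthogonal conformal Killing vector `ξ` such that
`∂_i κ` is parallel to `ξ_i`, i.e. `∂_i κ = c ξ_i` for a scalar function `c`. -/
def HasParallelTHOCKV (U : Set M) : Prop :=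
  ∃ (ξ : VField n M) (κ : M → ℝ), g.IsTHOCKV ξ κ U ∧
    ∀ p ∈ U, ∃ c : ℝ, diff n κ p = c • g.flat ξ p

/-- The diffeomorphism `φ = (t, q)` of an open set of `M` onto an open set of `ℝ × ℝⁿ` brings the
metric to the form `ds² = -b(q)² dt² + a(t)² g⋆_{μν}(q) dq^μ dq^ν`, with smooth positive scale
functions `a`, `b` and a smooth Riemannian metric `g⋆`. -/
structure IsDoublyWarpedChart (φ : OpenPartialHomeomorph M (ℝ × Space n)) (a : ℝ → ℝ)
    (b : Space n → ℝ) (gs : Space n → (Space n →L[ℝ] Space n →L[ℝ] ℝ)) : Prop where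
  smooth_chart : ContMDiffOn (𝓡 (n + 1)) 𝓘(ℝ, ℝ × Space n) ∞ φ φ.source
  smooth_symm : ContMDiffOn 𝓘(ℝ, ℝ × Space n) (𝓡 (n + 1)) ∞ φ.symm φ.target
  smooth_a : ContDiffOn ℝ ∞ a (Prod.fst '' φ.target)
  smooth_b : ContDiffOn ℝ ∞ b (Prod.snd '' φ.target)
  smooth_gs : ContDiffOn ℝ ∞ gs (Prod.snd '' φ.target)
  pos_a : ∀ t ∈ Prod.fst '' φ.target, 0 < a t
  pos_b : ∀ q ∈ Prod.snd '' φ.target, 0 < b q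
  symm_gs : ∀ q ∈ Prod.snd '' φ.target, ∀ v w, gs q v w = gs q w v
  pos_gs : ∀ q ∈ Prod.snd '' φ.target, ∀ v, v ≠ 0 → 0 < gs q v v
  metric_eq : ∀ p ∈ φ.source, ∀ v w : TangentSpace (𝓡 (n + 1)) p,
    let dv : ℝ × Space n := mfderiv (𝓡 (n + 1)) 𝓘(ℝ, ℝ × Space n) φ p v
    let dw : ℝ × Space n := mfderiv (𝓡 (n + 1)) 𝓘(ℝ, ℝ × Space n) φ p w
    g.val p v w = -(b (φ p).2) ^ 2 * (dv.1 * dw.1) + (a (φ p).1) ^ 2 * gs (φ p).2 dv.2 dw.2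

/-- There are coordinates `(t, q)` on `U` in which the metric has the doubly warped form
`ds² = -b(q)² dt² + a(t)² g⋆_{μν}(q) dq^μ dq^ν`. -/
def DoublyWarpedOn (U : Set M) : Prop :=
  ∃ (φ : OpenPartialHomeomorph M (ℝ × Space n)) (a : ℝ → ℝ) (b : Space n → ℝ)
    (gs : Space n → (Space n →L[ℝ] Space n →L[ℝ] ℝ)),
    φ.source = U ∧ g.IsDoublyWarpedChart φ a b gs

/-- There are coordinates `(t, q)` on `U` in which the metric has the warped (generalized
Robertson-Walker) form `ds² = -dt² + a(t)² g⋆_{μν}(q) dq^μ dq^ν`. -/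
def WarpedOn (U : Set M) : Prop :=
  ∃ (φ : OpenPartialHomeomorph M (ℝ × Space n)) (a : ℝ → ℝ)
    (gs : Space n → (Space n →L[ℝ] Space n →L[ℝ] ℝ)),
    φ.source = U ∧ g.IsDoublyWarpedChart φ a (fun _ ↦ 1) gs

end LorentzianMetric

end DoublyWarped

end

/-! From doubly warped coordinates to vectors: take `ξ = a ∂_t`. The Lie derivative of the metric
along `ξ` is `2a' g`, so `κ = a'(t)`. Lowering the index gives `ξ♭ = -b² a dt`, hence `dξ♭ = 2 d(log
b) ∧ ξ♭`, so that `α = d(log b)` is exact, and `dκ = a'' dt` is a multiple of `ξ♭`. One vector,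
`warpField`, therefore serves both criteria on the whole coordinate domain (`isTHOCKV_warpField`,
`associatedFormOn_warpField`, `diff_deriv_a`).

From vectors to coordinates: straighten `ξ` along its flow, starting from a hypersurface orthogonal
to it. In the coordinates `(s, q)` obtained, `ξ = ∂_s`, and the conformal Killing equation says that
every metric component satisfies the same linear equation `∂_s y = 2κ y`. With `N = g(ξ, ξ) < 0`,
the whole metric at `(s, q)` is therefore `N(s, q) / N(0, q)` times the metric at `(0, q)`
(`metricRep_ratio`). In particular `ξ` stays orthogonal to the slices (`exists_isConformalChart`).
If `N` separates, `-N = A(s)² B(q)²`, then the new time `t = ∫ A ds` turns the metric into `-B² dt²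
+ A² g⋆` with `g⋆ = A(0)⁻²` times the slice metric (`exists_isDoublyWarpedChart`).

Each hypothesis on `ξ` yields this separation. If `dα = 0`, then `α(∂_s) = 0` makes `α(∂_w)`
independent of `s`, and `∂_w N = 2 N α(∂_w)`, so `N(s, q) / N(0, q)` does not depend on `q`. If `dκ`
is parallel to `ξ♭`, then `κ` does not depend on `q`, so all functions `N(·, q)` solve one equation.
If `dξ♭ = 0`, then `∂_w N = 0`, so `B = 1` is possible and the metric is warped; moreover the
antisymmetric part of `∇ξ` vanishes, which gives `α = 0`.

The analytic input is smooth dependence of the flow on its initial point (`exists_smooth_flow`),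
derived from the inverse function theorem in a Banach space of paths. -/

noncomputable section

namespace DoublyWarped

open Filter Topology

/-! ### Inverse function theorem -/

/-- **Inverse function theorem** for smooth maps, as a local homeomorphism that is smooth in both
directions on its whole domain. -/
theorem exists_smooth_openPartialHomeomorph {E F : Type*} [NormedAddCommGroup E] [NormedSpace ℝ E]
    [CompleteSpace E] [NormedAddCommGroup F] [NormedSpace ℝ F] [CompleteSpace F] {f : E → F}
    {O : Set E} (hO : IsOpen O) (hf : ContDiffOn ℝ ∞ f O) {x₀ : E} (hx₀ : x₀ ∈ O)
    (e : E ≃L[ℝ] F) (he : HasFDerivAt f (e : E →L[ℝ] F) x₀) :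
    ∃ Φ : OpenPartialHomeomorph E F, x₀ ∈ Φ.source ∧ Φ.source ⊆ O ∧ (∀ x, Φ x = f x) ∧
      ContDiffOn ℝ ∞ Φ.symm Φ.target := by
  have hf₀ : ContDiffAt ℝ ∞ f x₀ := hf.contDiffAt (hO.mem_nhds hx₀)
  have hstrict : HasStrictFDerivAt f (e : E →L[ℝ] F) x₀ := hf₀.hasStrictFDerivAt' he (by simp)
  have hcont : ContinuousOn (fderiv ℝ f) O := hf.continuousOn_fderiv_of_isOpen hO (by simp)
  -- Invertible derivatives form an open set. Restricting to the points where the derivative is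
  -- invertible makes the inverse smooth on the entire target, not only near the image of `x₀`.
  have hS : IsOpen (O ∩ fderiv ℝ f ⁻¹' range ((↑) : (E ≃L[ℝ] F) → E →L[ℝ] F)) :=
    hcont.isOpen_inter_preimage hO ContinuousLinearEquiv.isOpen
  refine ⟨(hstrict.toOpenPartialHomeomorph f).restrOpen _ hS, ?_, ?_, ?_, ?_⟩
  · rw [OpenPartialHomeomorph.restrOpen_source]
    exact ⟨hstrict.mem_toOpenPartialHomeomorph_source, hx₀, e, he.fderiv.symm⟩
  · rw [OpenPartialHomeomorph.restrOpen_source]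
    exact fun x hx ↦ hx.2.1
  · intro x
    rfl
  · intro y hy
    set Φ := (hstrict.toOpenPartialHomeomorph f).restrOpen _ hS with hΦ
    have hmem : Φ.symm y ∈ Φ.source := Φ.map_target hy
    rw [hΦ, OpenPartialHomeomorph.restrOpen_source] at hmem
    obtain ⟨e', he'⟩ := hmem.2.2
    have hd : ContDiffAt ℝ ∞ f (Φ.symm y) := hf.contDiffAt (hO.mem_nhds hmem.2.1)
    have hfd : HasFDerivAt f (e' : E →L[ℝ] F) (Φ.symm y) := by
      rw [he']
      exact (hd.differentiableAt (by simp)).hasFDerivAt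
    exact (Φ.contDiffAt_symm hy hfd hd).contDiffWithinAt

/-! ### Superposition operators on spaces of continuous functions -/

section Superposition

variable {K : Type} [TopologicalSpace K] [CompactSpace K]

instance normedAddCommGroupContinuousMapCLM (E F : Type) [NormedAddCommGroup E] [NormedSpace ℝ E]
    [NormedAddCommGroup F] [NormedSpace ℝ F] : NormedAddCommGroup C(K, E →L[ℝ] F) :=
  ContinuousMap.instNormedAddCommGroup

instance normedSpaceContinuousMapCLM (E F : Type) [NormedAddCommGroup E] [NormedSpace ℝ E]
    [NormedAddCommGroup F] [NormedSpace ℝ F] : NormedSpace ℝ C(K, E →L[ℝ] F) :=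
  ContinuousMap.normedSpace

/-- Pointwise application of a continuous family of linear maps to a continuous family of
vectors, as a bilinear map. -/
def pointwiseApply (K : Type) [TopologicalSpace K] [CompactSpace K] (E F : Type)
    [NormedAddCommGroup E] [NormedSpace ℝ E] [NormedAddCommGroup F] [NormedSpace ℝ F] :
    C(K, E →L[ℝ] F) →L[ℝ] C(K, E) →L[ℝ] C(K, F) :=
  LinearMap.mkContinuous₂
    (LinearMap.mk₂ ℝ (fun A η ↦ (⟨fun t ↦ A t (η t), by fun_prop⟩ : C(K, F)))
      (fun _ _ _ ↦ by ext; simp) (fun _ _ _ ↦ by ext; simp) (fun _ _ _ ↦ by ext; simp)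
      (fun _ _ _ ↦ by ext; simp)) 1 (fun A η ↦ by
      rw [one_mul, ContinuousMap.norm_le _ (by positivity)]
      intro t
      refine ((A t).le_opNorm (η t)).trans ?_
      gcongr
      · exact A.norm_coe_le_norm t
      · exact η.norm_coe_le_norm t)

@[simp] theorem pointwiseApply_apply {E F : Type} [NormedAddCommGroup E] [NormedSpace ℝ E]
    [NormedAddCommGroup F] [NormedSpace ℝ F] (A : C(K, E →L[ℝ] F)) (η : C(K, E)) (t : K) :
    pointwiseApply K E F A η t = A t (η t) := rfl

/-- The range of `γ` is compact, so `v'` is uniformly close to `v' (γ t)` on balls of one radius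
around all points `γ t`. The mean value inequality on these balls bounds the remainder uniformly in
`t`, that is, in the sup norm. -/
theorem hasFDerivAt_superposition {E F : Type} [NormedAddCommGroup E] [NormedSpace ℝ E]
    [NormedAddCommGroup F] [NormedSpace ℝ F] {v : E → F} {v' : E → E →L[ℝ] F}
    (hv : ∀ x, HasFDerivAt v (v' x) x) (hc : Continuous v') (hvc : Continuous v) (γ : C(K, E)) :
    HasFDerivAt (fun η : C(K, E) ↦ (ContinuousMap.mk v hvc).comp η)
      (pointwiseApply K E F ((ContinuousMap.mk v' hc).comp γ)) γ := by
  rw [hasFDerivAt_iff_isLittleO_nhds_zero, Asymptotics.isLittleO_iff]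
  intro ε hε
  have hcpt : IsCompact (range γ) := isCompact_range γ.continuous
  have hunif := hcpt.uniformContinuousAt_of_continuousAt v' (fun a _ ↦ hc.continuousAt)
    (Metric.dist_mem_uniformity hε)
  obtain ⟨δ, hδ, hball⟩ := Metric.mem_uniformity_dist.1 hunif
  filter_upwards [Metric.ball_mem_nhds (0 : C(K, E)) hδ] with η hη
  rw [ContinuousMap.norm_le _ (by positivity)]
  intro t
  have hηt : ‖η t‖ < δ := (η.norm_coe_le_norm t).trans_lt (by simpa using hη)
  have key := (convex_ball (γ t) δ).norm_image_sub_le_of_norm_hasFDerivWithin_le'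
    (f := v) (f' := v') (φ := v' (γ t)) (C := ε) (x := γ t) (y := γ t + η t)
    (fun x _ ↦ (hv x).hasFDerivWithinAt) (fun x hx ↦ by
      have h1 : dist (γ t) x < δ := by rw [dist_comm]; exact hx
      have h2 := hball h1 (mem_range_self t)
      rw [mem_ofPred_eq, dist_comm, dist_eq_norm] at h2
      exact h2.le) (Metric.mem_ball_self hδ) (by simpa using hηt)
  simp only [add_sub_cancel_left] at key
  refine (le_trans (le_of_eq ?_) key).trans ?_
  · simp
  · gcongr
    exact η.norm_coe_le_norm t

/-- The superposition operator `η ↦ v ∘ η` on continuous functions on a compact space is as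
differentiable as `v`. -/
theorem contDiff_superposition {E : Type} [NormedAddCommGroup E] [NormedSpace ℝ E] (n : ℕ) :
    ∀ {F : Type} [NormedAddCommGroup F] [NormedSpace ℝ F] {v : E → F} (hv : ContDiff ℝ n v),
      ContDiff ℝ n (fun η : C(K, E) ↦ (ContinuousMap.mk v hv.continuous).comp η) := by
  -- The derivative of `η ↦ v ∘ η` is pointwise multiplication by `v' ∘ η`, again a superposition
  -- operator but with values in `E →L[ℝ] F`; this is why `F` is quantified inside the induction.
  induction n with
  | zero =>
    intro F _ _ v hv
    exact contDiff_zero.2 (ContinuousMap.continuous_postcomp _)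
  | succ n ih =>
    intro F _ _ v hv
    have hd : Differentiable ℝ v := hv.differentiable (by simp)
    have hc : ContDiff ℝ n (fderiv ℝ v) := hv.fderiv_right (by simp)
    have hder : ∀ γ, HasFDerivAt
        (fun η : C(K, E) ↦ (ContinuousMap.mk v hv.continuous).comp η)
        (pointwiseApply K E F ((ContinuousMap.mk _ hc.continuous).comp γ)) γ := fun γ ↦
      hasFDerivAt_superposition (fun x ↦ (hd x).hasFDerivAt) hc.continuous hv.continuous γ
    push_cast
    refine contDiff_succ_iff_hasFDerivAt.2 ⟨_, ?_, hder⟩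
    exact (pointwiseApply K E F).contDiff.comp (ih hc)

theorem contDiff_infty_superposition {E F : Type} [NormedAddCommGroup E] [NormedSpace ℝ E]
    [NormedAddCommGroup F] [NormedSpace ℝ F] {v : E → F} (hv : ContDiff ℝ ∞ v) :
    ContDiff ℝ ∞ (fun η : C(K, E) ↦ (ContinuousMap.mk v hv.continuous).comp η) :=
  contDiff_infty.2 fun n ↦ contDiff_superposition n (hv.of_le (by exact_mod_cast le_top))

end Superposition

/-! ### Flows depending smoothly on the initial point -/

section Flow

variable {E : Type} [NormedAddCommGroup E] [NormedSpace ℝ E]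

/-- The constant paths, as a continuous linear map. -/
def constPath (E : Type) [NormedAddCommGroup E] [NormedSpace ℝ E] : E →L[ℝ] C(unitInterval, E) :=
  LinearMap.mkContinuous
    { toFun := fun x ↦ ContinuousMap.const _ x
      map_add' := fun _ _ ↦ rfl
      map_smul' := fun _ _ ↦ rfl } 1 (fun x ↦ by
      rw [ContinuousMap.norm_le _ (by positivity), one_mul]
      exact fun _ ↦ le_rfl)

@[simp] theorem constPath_apply (x : E) (t : unitInterval) : constPath E x t = x := rfl

theorem continuous_IccExtend_path {E : Type} [NormedAddCommGroup E] (η : C(unitInterval, E)) :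
    Continuous (IccExtend zero_le_one η) :=
  η.continuous.Icc_extend'

/-- The primitive of a path that vanishes at `0`, as a continuous linear map. -/
def primitivePath (E : Type) [NormedAddCommGroup E] [NormedSpace ℝ E] :
    C(unitInterval, E) →L[ℝ] C(unitInterval, E) :=
  LinearMap.mkContinuous
    { toFun := fun η ↦ ⟨fun t ↦ ∫ u in (0 : ℝ)..t, IccExtend zero_le_one η u,
        (intervalIntegral.continuous_primitive
          (fun a b ↦ (continuous_IccExtend_path η).intervalIntegrable a b) 0).comp
            continuous_subtype_val⟩
      map_add' := fun η θ ↦ by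
        ext t
        exact intervalIntegral.integral_add
          ((continuous_IccExtend_path η).intervalIntegrable _ _)
          ((continuous_IccExtend_path θ).intervalIntegrable _ _)
      map_smul' := fun c η ↦ by
        ext t
        exact intervalIntegral.integral_smul c _ } 1 (fun η ↦ by
      rw [ContinuousMap.norm_le _ (by positivity), one_mul]
      intro t
      refine (intervalIntegral.norm_integral_le_of_norm_le_const (C := ‖η‖)
        (fun u _ ↦ η.norm_coe_le_norm _)).trans ?_
      rw [sub_zero, abs_of_nonneg t.2.1]
      exact mul_le_of_le_one_right (norm_nonneg _) t.2.2)

theorem primitivePath_apply (η : C(unitInterval, E)) (t : unitInterval) :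
    primitivePath E η t = ∫ u in (0 : ℝ)..t, IccExtend zero_le_one η u := rfl

/-- The map whose zeros in the last component are the solutions of `γ' = s v(γ)`, `γ(0) = x` on
the unit interval. -/
def pathEquation {v : E → E} (hv : Continuous v) (z : E × ℝ × C(unitInterval, E)) :
    E × ℝ × C(unitInterval, E) :=
  (z.1, z.2.1, z.2.2 - constPath E z.1
    - z.2.1 • primitivePath E ((ContinuousMap.mk v hv).comp z.2.2))

/-- The shear `(x, s, γ) ↦ (x, s, γ - x - s w)`. -/
def pathShear (w : C(unitInterval, E)) :
    (E × ℝ × C(unitInterval, E)) ≃L[ℝ] (E × ℝ × C(unitInterval, E)) :=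
  ContinuousLinearEquiv.equivOfInverse
    ((ContinuousLinearMap.fst ℝ _ _).prod
      (((ContinuousLinearMap.fst ℝ _ _).comp (ContinuousLinearMap.snd ℝ _ _)).prod
        ((ContinuousLinearMap.snd ℝ _ _).comp (ContinuousLinearMap.snd ℝ _ _)
          - (constPath E).comp (ContinuousLinearMap.fst ℝ _ _)
          - ((ContinuousLinearMap.fst ℝ _ _).comp
              (ContinuousLinearMap.snd ℝ _ _)).smulRight w)))
    ((ContinuousLinearMap.fst ℝ _ _).prod
      (((ContinuousLinearMap.fst ℝ _ _).comp (ContinuousLinearMap.snd ℝ _ _)).prod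
        ((ContinuousLinearMap.snd ℝ _ _).comp (ContinuousLinearMap.snd ℝ _ _)
          + (constPath E).comp (ContinuousLinearMap.fst ℝ _ _)
          + ((ContinuousLinearMap.fst ℝ _ _).comp
              (ContinuousLinearMap.snd ℝ _ _)).smulRight w)))
    (fun z ↦ by
      refine Prod.ext rfl (Prod.ext rfl ?_)
      simp only [ContinuousLinearMap.prod_apply, ContinuousLinearMap.coe_comp, Function.comp_apply,
        ContinuousLinearMap.smulRight_apply, ContinuousLinearMap.coe_fst', ContinuousLinearMap.coe_snd',
        sub_apply, add_apply]
      abel)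
    (fun z ↦ by
      refine Prod.ext rfl (Prod.ext rfl ?_)
      simp only [ContinuousLinearMap.prod_apply, ContinuousLinearMap.coe_comp, Function.comp_apply,
        ContinuousLinearMap.smulRight_apply, ContinuousLinearMap.coe_fst', ContinuousLinearMap.coe_snd',
        sub_apply, add_apply]
      abel)

theorem contDiff_pathEquation {v : E → E} (hv : ContDiff ℝ ∞ v) :
    ContDiff ℝ ∞ (pathEquation hv.continuous) := by
  have h := (contDiff_infty_superposition (K := unitInterval) hv)
  refine contDiff_fst.prodMk ((contDiff_fst.comp contDiff_snd).prodMk ?_)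
  refine ((contDiff_snd.comp contDiff_snd).sub
    ((constPath E).contDiff.comp contDiff_fst)).sub ?_
  exact (contDiff_fst.comp contDiff_snd).smul
    ((primitivePath E).contDiff.comp (h.comp (contDiff_snd.comp contDiff_snd)))

/-- At `s = 0` the nonlinear term is multiplied by zero, so its derivative in `γ` disappears and
only the direction of `s` feels `v`. What remains is a shear, which is invertible whatever `v` is.
-/
theorem hasFDerivAt_pathEquation {v : E → E} (hv : ContDiff ℝ ∞ v) (x₀ : E) :
    HasFDerivAt (pathEquation hv.continuous)
      (pathShear (primitivePath E ((ContinuousMap.mk v hv.continuous).comp (constPath E x₀))) :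
        (E × ℝ × C(unitInterval, E)) →L[ℝ] (E × ℝ × C(unitInterval, E)))
      (x₀, 0, constPath E x₀) := by
  have h := ((contDiff_infty_superposition (K := unitInterval) hv).differentiable (by simp)
    (constPath E x₀)).hasFDerivAt
  have hfst : HasFDerivAt (fun z : E × ℝ × C(unitInterval, E) ↦ z.1)
    (ContinuousLinearMap.fst ℝ _ _) (x₀, 0, constPath E x₀) := hasFDerivAt_fst
  have hmid : HasFDerivAt (fun z : E × ℝ × C(unitInterval, E) ↦ z.2.1)
    ((ContinuousLinearMap.fst ℝ _ _).comp (ContinuousLinearMap.snd ℝ _ _))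
    (x₀, 0, constPath E x₀) := hasFDerivAt_fst.comp _ hasFDerivAt_snd
  have hsnd : HasFDerivAt (fun z : E × ℝ × C(unitInterval, E) ↦ z.2.2)
    ((ContinuousLinearMap.snd ℝ _ _).comp (ContinuousLinearMap.snd ℝ _ _))
    (x₀, 0, constPath E x₀) := hasFDerivAt_snd.comp _ hasFDerivAt_snd
  have hv' := (primitivePath E).hasFDerivAt.comp _ (h.comp (x₀, (0 : ℝ), constPath E x₀) hsnd)
  have hsm := hmid.smul hv'
  have := hfst.prodMk (hmid.prodMk ((hsnd.sub ((constPath E).hasFDerivAt.comp _ hfst)).sub hsm))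
  refine this.congr_fderiv ?_
  refine ContinuousLinearMap.ext fun z ↦ Prod.ext rfl (Prod.ext rfl ?_)
  simp [pathShear]

/-- **Smooth dependence on initial conditions** for autonomous ordinary differential equations. -/
theorem exists_smooth_flow [CompleteSpace E] {v : E → E} (hv : ContDiff ℝ ∞ v) (x₀ : E) :
    ∃ ε > 0, ∃ Fl : E × ℝ → E, ContDiffOn ℝ ∞ Fl (Metric.ball x₀ ε ×ˢ Metric.ball 0 ε) ∧
      ∀ x ∈ Metric.ball x₀ ε, Fl (x, 0) = x ∧
        ∀ s ∈ Metric.ball (0 : ℝ) ε, HasDerivAt (fun s ↦ Fl (x, s)) (v (Fl (x, s))) s := by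
  obtain ⟨Φ, hmem, -, hΦ, hΦs⟩ := exists_smooth_openPartialHomeomorph isOpen_univ
    (contDiff_pathEquation hv).contDiffOn (mem_univ _) _ (hasFDerivAt_pathEquation hv x₀)
  obtain ⟨δ, hδ, hball⟩ := Metric.isOpen_iff.1 Φ.open_source _ hmem
  have hΦ0 : Φ (x₀, 0, constPath E x₀) = (x₀, 0, 0) := by
    rw [hΦ]
    refine Prod.ext rfl (Prod.ext rfl ?_)
    simp [pathEquation]
  have htarget : (x₀, (0 : ℝ), (0 : C(unitInterval, E))) ∈ Φ.target := hΦ0 ▸ Φ.map_source hmem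
  have hsymm0 : Φ.symm (x₀, 0, 0) = (x₀, 0, constPath E x₀) := by
    rw [← hΦ0, Φ.left_inv hmem]
  have hι : ContDiff ℝ ∞ (fun y : E × ℝ ↦ (y.1, y.2, (0 : C(unitInterval, E)))) := by fun_prop
  have hev : ∀ᶠ y : E × ℝ in 𝓝 (x₀, 0), (y.1, y.2, (0 : C(unitInterval, E))) ∈ Φ.target ∧
      Φ.symm (y.1, y.2, 0) ∈ Metric.ball (x₀, (0 : ℝ), constPath E x₀) δ := by
    have h1 := hι.continuous.continuousAt.preimage_mem_nhds (x := (x₀, (0 : ℝ)))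
      (Φ.open_target.mem_nhds htarget)
    have h2 : ContinuousAt (fun y : E × ℝ ↦ Φ.symm (y.1, y.2, 0)) (x₀, 0) :=
      ContinuousAt.comp (f := fun y : E × ℝ ↦ (y.1, y.2, (0 : C(unitInterval, E))))
        (Φ.continuousAt_symm htarget) hι.continuous.continuousAt
    have h3 := h2.preimage_mem_nhds
      (by rw [hsymm0]; exact Metric.ball_mem_nhds (x₀, (0 : ℝ), constPath E x₀) hδ)
    filter_upwards [h1, h3] with y hy1 hy3 using ⟨hy1, hy3⟩
  obtain ⟨ε', hε', hsub⟩ := Metric.eventually_nhds_iff_ball.1 hev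
  set ε := min ε' δ with hε
  have hεpos : 0 < ε := lt_min hε' hδ
  have hdom : ∀ x ∈ Metric.ball x₀ ε, ∀ s ∈ Metric.ball (0 : ℝ) ε,
      (x, s) ∈ Metric.ball (x₀, (0 : ℝ)) ε' := fun x hx s hs ↦ by
    rw [← ball_prod_same]
    exact ⟨Metric.ball_subset_ball (min_le_left _ _) hx,
      Metric.ball_subset_ball (min_le_left _ _) hs⟩
  -- `S (x, s)` is the path on the unit interval with `γ' = s v(γ)` and `γ(0) = x`; its endpoint is
  -- the flow of `x` at time `s`.
  set S : E × ℝ → C(unitInterval, E) := fun y ↦ (Φ.symm (y.1, y.2, 0)).2.2 with hS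
  have hSsol : ∀ x ∈ Metric.ball x₀ ε, ∀ s ∈ Metric.ball (0 : ℝ) ε,
      dist (S (x, s)) (constPath E x₀) < δ ∧ ∀ t, S (x, s) t =
        x + s • ∫ u in (0 : ℝ)..t, v (IccExtend zero_le_one (S (x, s)) u) := by
    intro x hx s hs
    obtain ⟨h1, h2⟩ := hsub _ (hdom x hx s hs)
    have h3 := Φ.right_inv h1
    rw [hΦ] at h3
    have hx' : (Φ.symm (x, s, 0)).1 = x := congrArg Prod.fst h3
    have hs' : (Φ.symm (x, s, 0)).2.1 = s := congrArg (fun z ↦ z.2.1) h3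
    have h4 := congrArg (fun z ↦ z.2.2) h3
    simp only [pathEquation, hx', hs'] at h4
    refine ⟨?_, fun t ↦ ?_⟩
    · rw [← ball_prod_same, ← ball_prod_same] at h2
      exact h2.2.2
    · have h5 := DFunLike.congr_fun h4 t
      simp only [ContinuousMap.sub_apply, constPath_apply, ContinuousMap.smul_apply,
        primitivePath_apply, ContinuousMap.zero_apply] at h5
      rw [sub_sub, sub_eq_zero] at h5
      exact h5
  -- Uniqueness of solutions near the constant path is the injectivity of the local homeomorphism
  -- `Φ`.
  have huniq : ∀ x ∈ Metric.ball x₀ ε, ∀ s ∈ Metric.ball (0 : ℝ) ε, ∀ η : C(unitInterval, E),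
      dist η (constPath E x₀) < δ → (∀ t, η t =
        x + s • ∫ u in (0 : ℝ)..t, v (IccExtend zero_le_one η u)) → S (x, s) = η := by
    intro x hx s hs η hη heq
    have hin : (x, s, η) ∈ Φ.source := by
      refine hball ?_
      rw [← ball_prod_same, ← ball_prod_same]
      exact ⟨Metric.ball_subset_ball (min_le_right _ _) hx,
        Metric.ball_subset_ball (min_le_right _ _) hs, hη⟩
    have hval : Φ (x, s, η) = (x, s, 0) := by
      rw [hΦ]
      refine Prod.ext rfl (Prod.ext rfl ?_)
      ext t
      simp only [pathEquation, ContinuousMap.sub_apply, constPath_apply, ContinuousMap.smul_apply,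
        primitivePath_apply, ContinuousMap.zero_apply]
      rw [sub_sub, sub_eq_zero]
      exact heq t
    rw [hS]
    simp only
    rw [← hval, Φ.left_inv hin]
  -- The reparametrised path `t ↦ γ(σ t)` solves the equation with `s` replaced by `s σ`, so
  -- uniqueness identifies it with `S (x, s σ)`.
  have hscale : ∀ x ∈ Metric.ball x₀ ε, ∀ s ∈ Metric.ball (0 : ℝ) ε, ∀ σ : unitInterval,
      S (x, s * σ) 1 = S (x, s) σ := by
    intro x hx s hs σ
    obtain ⟨h1, h2⟩ := hSsol x hx s hs
    have hsσ : s * σ ∈ Metric.ball (0 : ℝ) ε := by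
      rw [mem_ball_zero_iff] at hs ⊢
      rw [norm_mul, Real.norm_of_nonneg σ.2.1]
      exact (mul_le_of_le_one_right (norm_nonneg _) σ.2.2).trans_lt hs
    have := huniq x hx (s * σ) hsσ ((S (x, s)).comp ⟨fun t ↦ σ * t, by fun_prop⟩) ?_ ?_
    · rw [this]
      simp
    · refine lt_of_le_of_lt ?_ h1
      rw [ContinuousMap.dist_le dist_nonneg]
      exact fun t ↦ ContinuousMap.dist_apply_le_dist (f := S (x, s)) (g := constPath E x₀) _
    · intro t
      simp only [ContinuousMap.comp_apply, ContinuousMap.coe_mk]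
      rw [h2, mul_smul]
      congr 2
      have h6 : ∀ u ∈ uIcc (0 : ℝ) t, v (IccExtend zero_le_one
          ((S (x, s)).comp ⟨fun t ↦ σ * t, by fun_prop⟩) u)
          = (fun u ↦ v (IccExtend zero_le_one (S (x, s)) u)) ((σ : ℝ) * u) := by
        intro u hu
        rw [uIcc_of_le t.2.1] at hu
        have hu1 : u ∈ Icc (0 : ℝ) 1 := ⟨hu.1, hu.2.trans t.2.2⟩
        have hu2 : (σ : ℝ) * u ∈ Icc (0 : ℝ) 1 := unitInterval.mul_mem σ.2 hu1
        simp only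
        rw [IccExtend_of_mem _ _ hu1, IccExtend_of_mem _ _ hu2]
        rfl
      rw [intervalIntegral.integral_congr h6]
      refine Eq.trans ?_ (intervalIntegral.smul_integral_comp_mul_left
        (fun u ↦ v (IccExtend zero_le_one (S (x, s)) u)) (σ : ℝ)).symm
      simp
  have hdiff : ContDiffOn ℝ ∞ (fun y ↦ S y 1) (Metric.ball x₀ ε ×ˢ Metric.ball 0 ε) := by
    have h1 : ContDiffOn ℝ ∞ (fun y : E × ℝ ↦ Φ.symm (y.1, y.2, 0))
        (Metric.ball x₀ ε ×ˢ Metric.ball 0 ε) :=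
      hΦs.comp hι.contDiffOn fun y hy ↦ (hsub _ (hdom y.1 hy.1 y.2 hy.2)).1
    exact (ContinuousMap.evalCLM ℝ (1 : unitInterval)).contDiff.comp_contDiffOn
      ((contDiff_snd.comp contDiff_snd).comp_contDiffOn h1)
  refine ⟨ε, hεpos, fun y ↦ S y 1, hdiff, fun x hx ↦ ⟨?_, fun s hs ↦ ?_⟩⟩
  · simpa using (hSsol x hx 0 (Metric.mem_ball_self hεpos)).2 1
  · have hint : ∀ s ∈ Metric.ball (0 : ℝ) ε,
        S (x, s) 1 = x + ∫ u in (0 : ℝ)..s, v (S (x, u) 1) := by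
      intro s hs
      rw [(hSsol x hx s hs).2 1]
      have h6 : ∀ u ∈ uIcc (0 : ℝ) ((1 : unitInterval) : ℝ),
          v (IccExtend zero_le_one (S (x, s)) u) = (fun u ↦ v (S (x, u) 1)) (s * u) := by
        intro u hu
        rw [uIcc_of_le (by simp)] at hu
        have hu1 : u ∈ Icc (0 : ℝ) 1 := hu
        rw [IccExtend_of_mem _ _ hu1, ← hscale x hx s hs ⟨u, hu1⟩]
      rw [intervalIntegral.integral_congr h6]
      refine congrArg (x + ·) ((intervalIntegral.smul_integral_comp_mul_left
        (fun u ↦ v (S (x, u) 1)) s).trans ?_)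
      simp
    have hcont : ContinuousOn (fun u ↦ v (S (x, u) 1)) (Metric.ball (0 : ℝ) ε) :=
      hv.continuous.comp_continuousOn (hdiff.continuousOn.comp (by fun_prop)
        fun u hu ↦ ⟨hx, hu⟩)
    have hev : (fun s ↦ x + ∫ u in (0 : ℝ)..s, v (S (x, u) 1)) =ᶠ[𝓝 s] fun s ↦ S (x, s) 1 := by
      filter_upwards [Metric.isOpen_ball.mem_nhds hs] with r hr using (hint r hr).symm
    refine HasDerivAt.congr_of_eventuallyEq ?_ hev.symm
    refine HasDerivAt.const_add _ ?_
    have hsub' : uIcc 0 s ⊆ Metric.ball (0 : ℝ) ε := by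
      have := (convex_ball (0 : ℝ) ε).ordConnected
      exact this.uIcc_subset (Metric.mem_ball_self hεpos) hs
    exact intervalIntegral.integral_hasDerivAt_right
      ((hcont.mono hsub').intervalIntegrable)
      (hcont.stronglyMeasurableAtFilter Metric.isOpen_ball s hs)
      (hcont.continuousAt (Metric.isOpen_ball.mem_nhds hs))

end Flow

/-! ### Straightening a transverse vector field -/

section Straightening

variable {E : Type} [NormedAddCommGroup E] [NormedSpace ℝ E] [FiniteDimensional ℝ E]

/-- A smooth vector field on an open set agrees near a given point with a globally smooth one. -/
theorem exists_contDiff_eventuallyEq {F : Type} [NormedAddCommGroup F] [NormedSpace ℝ F]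
    {v : E → F} {Ω : Set E} (hΩ : IsOpen Ω) (hv : ContDiffOn ℝ ∞ v Ω) {x₀ : E} (hx₀ : x₀ ∈ Ω) :
    ∃ v' : E → F, ContDiff ℝ ∞ v' ∧ v' =ᶠ[𝓝 x₀] v := by
  obtain ⟨r, hr, hball⟩ := Metric.nhds_basis_closedBall.mem_iff.1 (hΩ.mem_nhds hx₀)
  -- The support of the bump is the closed ball of radius `r`, contained in `Ω`, so the product
  -- vanishes near every point outside `Ω`, where nothing is known about `v`.
  let f : ContDiffBump x₀ := ⟨r / 2, r, by positivity, by linarith⟩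
  refine ⟨fun x ↦ f x • v x, contDiff_iff_contDiffAt.2 fun x ↦ ?_, ?_⟩
  · by_cases hx : x ∈ Ω
    · exact f.contDiff.contDiffAt.smul (hv.contDiffAt (hΩ.mem_nhds hx))
    · have hx' : x ∉ tsupport f := by
        rw [f.tsupport_eq]
        exact fun h ↦ hx (hball h)
      have h0 : (fun x ↦ f x • v x) =ᶠ[𝓝 x] fun _ ↦ 0 := by
        filter_upwards [notMem_tsupport_iff_eventuallyEq.1 hx'] with y hy
        simp [hy]
      exact contDiffAt_const.congr_of_eventuallyEq h0
  · filter_upwards [f.eventuallyEq_one] with y hy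
    simp [hy]

/-- A linear functional that does not vanish on `w` is the first component of linear coordinates
in which `w` points along the first axis. -/
theorem exists_linear_coordinates {n : ℕ} (hE : Module.finrank ℝ E = n + 1) (ℓ : E →L[ℝ] ℝ) (w : E)
    (hw : ℓ w ≠ 0) :
    ∃ L : E ≃L[ℝ] ℝ × Space n, (∀ x, (L x).1 = ℓ x) ∧ L w = (ℓ w, 0) := by
  have hne : (ℓ : E →ₗ[ℝ] ℝ) ≠ 0 := fun h ↦ hw (by simpa using LinearMap.congr_fun h w)
  have hker : Module.finrank ℝ (LinearMap.ker (ℓ : E →ₗ[ℝ] ℝ)) = Module.finrank ℝ (Space n) := by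
    have := Module.Dual.finrank_ker_add_one_of_ne_zero (f := (ℓ : E →ₗ[ℝ] ℝ)) hne
    rw [hE] at this
    rw [finrank_euclideanSpace_fin]
    exact Nat.succ_injective this
  let e : LinearMap.ker (ℓ : E →ₗ[ℝ] ℝ) ≃ₗ[ℝ] Space n := LinearEquiv.ofFinrankEq _ _ hker
  -- `P` is the projection onto the kernel of `ℓ` along `w`; it vanishes on `w`.
  let P : E →ₗ[ℝ] LinearMap.ker (ℓ : E →ₗ[ℝ] ℝ) :=
    LinearMap.codRestrict _ (LinearMap.id - ((ℓ w)⁻¹ • (ℓ : E →ₗ[ℝ] ℝ)).smulRight w) (fun x ↦ by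
      simp [hw, mul_assoc, mul_comm (ℓ x)])
  let T : E →ₗ[ℝ] ℝ × Space n := (ℓ : E →ₗ[ℝ] ℝ).prod (e.toLinearMap.comp P)
  have hT : Function.Injective T := by
    refine (injective_iff_map_eq_zero T).2 fun x hx ↦ ?_
    have h1 : ℓ x = 0 := congrArg Prod.fst hx
    have h2 : e (P x) = 0 := congrArg Prod.snd hx
    have h3 : ((P x : LinearMap.ker (ℓ : E →ₗ[ℝ] ℝ)) : E) = 0 := by
      rw [e.map_eq_zero_iff.1 h2]
      rfl
    have h4 : x - ((ℓ w)⁻¹ * ℓ x) • w = 0 := h3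
    simpa [h1] using h4
  have hdim : Module.finrank ℝ E = Module.finrank ℝ (ℝ × Space n) := by
    rw [hE, Module.finrank_prod, Module.finrank_self, finrank_euclideanSpace_fin, add_comm]
  refine ⟨(LinearMap.linearEquivOfInjective T hT hdim).toContinuousLinearEquiv, fun x ↦ rfl, ?_⟩
  refine Prod.ext rfl ?_
  have : P w = 0 := Subtype.ext (by
    change w - ((ℓ w)⁻¹ * ℓ w) • w = 0
    simp [hw])
  change e (P w) = 0
  rw [this, map_zero]

/-- **Straightening** of a vector field transverse to the level sets of a function, starting from
one of these level sets. -/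
theorem exists_straightening {n : ℕ} (hE : Module.finrank ℝ E = n + 1) {Ω : Set E}
    (hΩ : IsOpen Ω) {v : E → E} (hv : ContDiffOn ℝ ∞ v Ω) {h : E → ℝ} (hh : ContDiffOn ℝ ∞ h Ω)
    {x₀ : E} (hx₀ : x₀ ∈ Ω) (htr : fderiv ℝ h x₀ (v x₀) ≠ 0) :
    ∃ Ψ : OpenPartialHomeomorph (ℝ × Space n) E, ∃ ε > 0,
      Ψ.source = Metric.ball (0 : ℝ) ε ×ˢ Metric.ball (0 : Space n) ε ∧ Ψ.target ⊆ Ω ∧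
      Ψ (0, 0) = x₀ ∧ ContDiffOn ℝ ∞ Ψ Ψ.source ∧ ContDiffOn ℝ ∞ Ψ.symm Ψ.target ∧
      (∀ z ∈ Ψ.source, fderiv ℝ Ψ z (1, 0) = v (Ψ z)) ∧
      ∀ q ∈ Metric.ball (0 : Space n) ε, h (Ψ (0, q)) = h x₀ := by
  have : CompleteSpace E := FiniteDimensional.complete ℝ E
  obtain ⟨v', hv', hvv'⟩ := exists_contDiff_eventuallyEq hΩ hv hx₀
  obtain ⟨W, hWsub, hWo, hxW⟩ := eventually_nhds_iff.1 (hvv'.and (hΩ.eventually_mem hx₀))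
  obtain ⟨L, hL1, hLv⟩ := exists_linear_coordinates hE (fderiv ℝ h x₀) (v x₀) htr
  obtain ⟨δ, hδ, Fl, hFl, hFlow⟩ := exists_smooth_flow hv' x₀
  have hhd : HasFDerivAt h (fderiv ℝ h x₀) x₀ :=
    ((hh.contDiffAt (hΩ.mem_nhds hx₀)).differentiableAt (by simp)).hasFDerivAt
  -- Coordinates whose first component is `h - h x₀`: the slice where it vanishes parametrises the
  -- level set through `x₀`. The derivative at `x₀` is `L`, because the first component of `L` is
  -- the differential of `h`.
  obtain ⟨Θ, hΘmem, hΘsub, hΘ, hΘs⟩ := exists_smooth_openPartialHomeomorph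
    (f := fun x : E ↦ (h x - h x₀, (L (x - x₀)).2)) hΩ
    ((hh.sub contDiffOn_const).prodMk ((contDiff_snd.comp
      (L.contDiff.comp (contDiff_id.sub contDiff_const))).contDiffOn)) hx₀ L (by
      have h2 : HasFDerivAt (fun x ↦ (L (x - x₀)).2)
          ((ContinuousLinearMap.snd ℝ ℝ (Space n)).comp (L : E →L[ℝ] ℝ × Space n)) x₀ :=
        hasFDerivAt_snd.comp x₀ ((L.hasFDerivAt).comp x₀ ((hasFDerivAt_id x₀).sub_const x₀))
      refine ((hhd.sub_const (h x₀)).prodMk h2).congr_fderiv ?_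
      exact ContinuousLinearMap.ext fun x ↦ Prod.ext (hL1 x).symm rfl)
  have hΘ0 : Θ x₀ = (0, 0) := by
    rw [hΘ]
    simp
  have h0t : ((0 : ℝ), (0 : Space n)) ∈ Θ.target := hΘ0 ▸ Θ.map_source hΘmem
  have hΘs0 : Θ.symm (0, 0) = x₀ := by rw [← hΘ0, Θ.left_inv hΘmem]
  set ι : Space n → E := fun q ↦ Θ.symm (0, q) with hι
  have hinc : ContDiff ℝ ∞ (fun q : Space n ↦ ((0 : ℝ), q)) := by fun_prop
  set Q : Set (Space n) := (fun q ↦ ((0 : ℝ), q)) ⁻¹' Θ.target with hQ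
  have hQo : IsOpen Q := Θ.open_target.preimage hinc.continuous
  have hιs : ContDiffOn ℝ ∞ ι Q := hΘs.comp hinc.contDiffOn fun q hq ↦ hq
  set Q' := Q ∩ ι ⁻¹' Metric.ball x₀ δ with hQ'
  have hQ'o : IsOpen Q' := hιs.continuousOn.isOpen_inter_preimage hQo Metric.isOpen_ball
  have h0Q' : (0 : Space n) ∈ Q' := ⟨h0t, by
    change Θ.symm (0, 0) ∈ Metric.ball x₀ δ
    rw [hΘs0]
    exact Metric.mem_ball_self hδ⟩
  -- Start at the point of the level set with parameter `z.2` and follow the flow for the time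
  -- `z.1`.
  set Ψ₀ : ℝ × Space n → E := fun z ↦ Fl (ι z.2, z.1) with hΨ₀
  have hΨs : ContDiffOn ℝ ∞ Ψ₀ (Metric.ball 0 δ ×ˢ Q') := by
    refine hFl.comp (t := Metric.ball x₀ δ ×ˢ Metric.ball 0 δ) ?_ fun z hz ↦ ⟨hz.2.2, hz.1⟩
    exact (hιs.comp contDiff_snd.contDiffOn fun z hz ↦ hz.2.1).prodMk contDiff_fst.contDiffOn
  have hO₁ : IsOpen (Metric.ball (0 : ℝ) δ ×ˢ Q') := Metric.isOpen_ball.prod hQ'o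
  -- The flow belongs to the globally smooth extension `v'`; the set `W` ensures that it agrees with
  -- `v` where it is used.
  set O := (Metric.ball (0 : ℝ) δ ×ˢ Q') ∩ Ψ₀ ⁻¹' W with hO
  have hOo : IsOpen O := hΨs.continuousOn.isOpen_inter_preimage hO₁ hWo
  have hΨzero : ∀ q ∈ Q', Ψ₀ (0, q) = ι q := fun q hq ↦ (hFlow _ hq.2).1
  have hι0 : ι 0 = x₀ := hΘs0
  have hΨ00 : Ψ₀ (0, 0) = x₀ := (hΨzero 0 h0Q').trans hι0
  have h0O : ((0 : ℝ), (0 : Space n)) ∈ O := ⟨⟨Metric.mem_ball_self hδ, h0Q'⟩, by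
    change Ψ₀ (0, 0) ∈ W
    rwa [hΨ00]⟩
  have hflowΨ : ∀ z ∈ O, fderiv ℝ Ψ₀ z (1, 0) = v (Ψ₀ z) := by
    intro z hz
    have hd : HasFDerivAt Ψ₀ (fderiv ℝ Ψ₀ z) z :=
      ((hΨs.contDiffAt (hO₁.mem_nhds hz.1)).differentiableAt (by simp)).hasFDerivAt
    have hc : HasDerivAt (fun s : ℝ ↦ (s, z.2)) ((1 : ℝ), (0 : Space n)) z.1 :=
      (hasDerivAt_id z.1).prodMk (hasDerivAt_const z.1 z.2)
    have h1 : HasDerivAt (fun s ↦ Ψ₀ (s, z.2)) (fderiv ℝ Ψ₀ z (1, 0)) z.1 :=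
      HasFDerivAt.comp_hasDerivAt (f := fun s : ℝ ↦ (s, z.2)) z.1 hd hc
    have h2 := (hFlow (ι z.2) hz.1.2.2).2 z.1 hz.1.1
    exact (h1.unique h2).trans (hWsub _ hz.2).1
  have hd0 : HasFDerivAt Ψ₀ (fderiv ℝ Ψ₀ (0, 0)) (0, 0) :=
    ((hΨs.contDiffAt (hO₁.mem_nhds h0O.1)).differentiableAt (by simp)).hasFDerivAt
  have hder0 : ∀ w : Space n, fderiv ℝ Ψ₀ (0, 0) (0, w) = L.symm (0, w) := by
    intro w
    have hinc' : HasFDerivAt (fun q : Space n ↦ ((0 : ℝ), q)) (ContinuousLinearMap.inr ℝ ℝ (Space n))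
        0 := (ContinuousLinearMap.inr ℝ ℝ (Space n)).hasFDerivAt
    have h1 : HasFDerivAt (fun q ↦ Ψ₀ (0, q))
        ((fderiv ℝ Ψ₀ (0, 0)).comp (ContinuousLinearMap.inr ℝ ℝ (Space n))) 0 :=
      HasFDerivAt.comp (f := fun q : Space n ↦ ((0 : ℝ), q)) 0 hd0 hinc'
    have hΘd : HasFDerivAt Θ (L : E →L[ℝ] ℝ × Space n) (Θ.symm (0, 0)) := by
      rw [hΘs0]
      have h2 : HasFDerivAt (fun x ↦ (L (x - x₀)).2)
          ((ContinuousLinearMap.snd ℝ ℝ (Space n)).comp (L : E →L[ℝ] ℝ × Space n)) x₀ :=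
        hasFDerivAt_snd.comp x₀ ((L.hasFDerivAt).comp x₀ ((hasFDerivAt_id x₀).sub_const x₀))
      have h3 : (Θ : E → ℝ × Space n) = fun x ↦ (h x - h x₀, (L (x - x₀)).2) := funext hΘ
      rw [h3]
      refine ((hhd.sub_const (h x₀)).prodMk h2).congr_fderiv ?_
      exact ContinuousLinearMap.ext fun x ↦ Prod.ext (hL1 x).symm rfl
    have h4 : HasFDerivAt ι ((L.symm : (ℝ × Space n) →L[ℝ] E).comp
        (ContinuousLinearMap.inr ℝ ℝ (Space n))) 0 :=
      HasFDerivAt.comp (f := fun q : Space n ↦ ((0 : ℝ), q)) 0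
        (Θ.hasFDerivAt_symm h0t hΘd) hinc'
    have h5 : (fun q ↦ Ψ₀ (0, q)) =ᶠ[𝓝 0] ι := by
      filter_upwards [hQ'o.mem_nhds h0Q'] with q hq using hΨzero q hq
    exact DFunLike.congr_fun (h1.unique (h4.congr_of_eventuallyEq h5)) w
  -- At the origin `(1, 0)` goes to `v x₀`, and `(0, w)` goes to a vector tangent to the level set.
  -- Transversality makes the two images independent.
  have hinj : Function.Injective (fderiv ℝ Ψ₀ (0, 0) : ℝ × Space n →ₗ[ℝ] E) := by
    refine (injective_iff_map_eq_zero _).2 fun z hz ↦ ?_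
    have hz' : fderiv ℝ Ψ₀ (0, 0) z = 0 := hz
    have hdec : z = z.1 • ((1 : ℝ), (0 : Space n)) + (0, z.2) := by
      refine Prod.ext ?_ ?_ <;> simp
    rw [hdec, map_add, map_smul, hflowΨ _ h0O, hΨ00, hder0] at hz'
    have h6 := congrArg L hz'
    rw [map_add, map_smul, hLv, L.apply_symm_apply, map_zero] at h6
    have h7 : z.1 * fderiv ℝ h x₀ (v x₀) = 0 := by simpa using congrArg Prod.fst h6
    have h8 : z.2 = 0 := by simpa using congrArg Prod.snd h6
    exact Prod.ext ((mul_eq_zero.1 h7).resolve_right htr) h8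
  have hdim : Module.finrank ℝ (ℝ × Space n) = Module.finrank ℝ E := by
    rw [hE, Module.finrank_prod, Module.finrank_self, finrank_euclideanSpace_fin, add_comm]
  obtain ⟨Φ, hΦ0, hΦO, hΦ, hΦs⟩ := exists_smooth_openPartialHomeomorph hOo
    (hΨs.mono inter_subset_left) h0O
    ((LinearMap.linearEquivOfInjective _ hinj hdim).toContinuousLinearEquiv)
    (hd0.congr_fderiv (ContinuousLinearMap.ext fun z ↦ rfl))
  have hΦe : (Φ : ℝ × Space n → E) = Ψ₀ := funext hΦ
  obtain ⟨ε, hε, hball⟩ := Metric.isOpen_iff.1 Φ.open_source _ hΦ0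
  rw [← ball_prod_same] at hball
  have hBo : IsOpen (Metric.ball (0 : ℝ) ε ×ˢ Metric.ball (0 : Space n) ε) :=
    Metric.isOpen_ball.prod Metric.isOpen_ball
  have hsrc : (Φ.restrOpen _ hBo).source
      = Metric.ball (0 : ℝ) ε ×ˢ Metric.ball (0 : Space n) ε := by
    rw [OpenPartialHomeomorph.restrOpen_source, inter_eq_right]
    exact hball
  have hcoe : ((Φ.restrOpen _ hBo : OpenPartialHomeomorph _ _) : ℝ × Space n → E) = Ψ₀ := hΦe
  have htgt : (Φ.restrOpen _ hBo).target ⊆ Φ.target := fun y hy ↦ by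
    have := (Φ.restrOpen _ hBo).map_target hy
    rw [OpenPartialHomeomorph.restrOpen_source] at this
    have h9 := (Φ.restrOpen _ hBo).right_inv hy
    rw [← h9]
    exact Φ.map_source this.1
  have hmemO : ∀ z ∈ (Φ.restrOpen _ hBo).source, z ∈ O := fun z hz ↦ hΦO (hball (hsrc ▸ hz))
  refine ⟨Φ.restrOpen _ hBo, ε, hε, hsrc, ?_, ?_, ?_, ?_, ?_, ?_⟩
  · intro y hy
    rw [← (Φ.restrOpen _ hBo).right_inv hy, hcoe]
    exact (hWsub _ (hmemO _ ((Φ.restrOpen _ hBo).map_target hy)).2).2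
  · rw [hcoe, hΨ00]
  · rw [hcoe]
    exact hΨs.mono fun z hz ↦ (hmemO z hz).1
  · exact hΦs.mono htgt
  · rw [hcoe]
    exact fun z hz ↦ hflowΨ z (hmemO z hz)
  · intro q hq
    have hz := hmemO (0, q) (by rw [hsrc]; exact ⟨Metric.mem_ball_self hε, hq⟩)
    rw [hcoe, hΨzero q hz.1.2]
    have h10 := Θ.right_inv (x := (0, q)) hz.1.2.1
    rw [hΘ] at h10
    exact sub_eq_zero.1 (congrArg Prod.fst h10)

end Straightening

/-! ### Vector fields and functions in coordinates -/

theorem mlieBracket_eq_lieBracket {E : Type*} [NormedAddCommGroup E] [NormedSpace ℝ E]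
    (V W : (x : E) → TangentSpace 𝓘(ℝ, E) x) (x : E) :
    mlieBracket 𝓘(ℝ, E) V W x = lieBracket ℝ V W x := by
  rw [← mlieBracketWithin_univ, mlieBracketWithin_eq_lieBracketWithin]
  exact congrFun lieBracketWithin_univ x

section Coordinates

variable {n : ℕ} {M : Type*} [TopologicalSpace M] [ChartedSpace (Model n) M]

/-- The coordinate homeomorphism `φ` is smooth in both directions. -/
structure IsSmoothChart (φ : OpenPartialHomeomorph M (ℝ × Space n)) : Prop where
  smooth : ContMDiffOn (𝓡 (n + 1)) 𝓘(ℝ, ℝ × Space n) ∞ φ φ.source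
  smooth_symm : ContMDiffOn 𝓘(ℝ, ℝ × Space n) (𝓡 (n + 1)) ∞ φ.symm φ.target

/-- The derivative of the coordinate map. -/
def chartDeriv (φ : OpenPartialHomeomorph M (ℝ × Space n)) (p : M) :
    TangentSpace (𝓡 (n + 1)) p →L[ℝ] ℝ × Space n :=
  mfderiv (𝓡 (n + 1)) 𝓘(ℝ, ℝ × Space n) φ p

/-- The derivative of the inverse of the coordinate map. -/
def chartSymmDeriv (φ : OpenPartialHomeomorph M (ℝ × Space n)) (x : ℝ × Space n) :
    (ℝ × Space n) →L[ℝ] TangentSpace (𝓡 (n + 1)) (φ.symm x) :=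
  mfderiv 𝓘(ℝ, ℝ × Space n) (𝓡 (n + 1)) φ.symm x

/-- The components of a vector field in the coordinates `φ`. -/
def rep (φ : OpenPartialHomeomorph M (ℝ × Space n)) (X : VField n M) (x : ℝ × Space n) :
    ℝ × Space n :=
  chartDeriv φ (φ.symm x) (X (φ.symm x))

/-- The vector field with given components in the coordinates `φ`. -/
def ofRep (φ : OpenPartialHomeomorph M (ℝ × Space n)) (V : ℝ × Space n → ℝ × Space n) :
    VField n M :=
  mpullback (𝓡 (n + 1)) 𝓘(ℝ, ℝ × Space n) φ (fun x ↦ (V x : TangentSpace 𝓘(ℝ, ℝ × Space n) x))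

variable {φ : OpenPartialHomeomorph M (ℝ × Space n)}

namespace IsSmoothChart

theorem contMDiffAt (hφ : IsSmoothChart φ) {p : M} (hp : p ∈ φ.source) :
    ContMDiffAt (𝓡 (n + 1)) 𝓘(ℝ, ℝ × Space n) ∞ φ p :=
  hφ.smooth.contMDiffAt (φ.open_source.mem_nhds hp)

theorem contMDiffAt_symm (hφ : IsSmoothChart φ) {x : ℝ × Space n} (hx : x ∈ φ.target) :
    ContMDiffAt 𝓘(ℝ, ℝ × Space n) (𝓡 (n + 1)) ∞ φ.symm x :=
  hφ.smooth_symm.contMDiffAt (φ.open_target.mem_nhds hx)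

theorem mdifferentiable (hφ : IsSmoothChart φ) :
    φ.MDifferentiable (𝓡 (n + 1)) 𝓘(ℝ, ℝ × Space n) :=
  ⟨hφ.smooth.mdifferentiableOn (by simp), hφ.smooth_symm.mdifferentiableOn (by simp)⟩

theorem chartDeriv_symm (hφ : IsSmoothChart φ) {x : ℝ × Space n} (hx : x ∈ φ.target)
    (a : ℝ × Space n) : chartDeriv φ (φ.symm x) (chartSymmDeriv φ x a) = a :=
  DFunLike.congr_fun (hφ.mdifferentiable.comp_symm_deriv hx) a

theorem chartDeriv_injective (hφ : IsSmoothChart φ) {p : M} (hp : p ∈ φ.source) :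
    Function.Injective (chartDeriv φ p) :=
  hφ.mdifferentiable.mfderiv_injective hp

theorem chartDeriv_surjective (hφ : IsSmoothChart φ) {p : M} (hp : p ∈ φ.source) :
    Function.Surjective (chartDeriv φ p) :=
  hφ.mdifferentiable.mfderiv_surjective hp

theorem isInvertible (hφ : IsSmoothChart φ) {p : M} (hp : p ∈ φ.source) :
    (mfderiv (𝓡 (n + 1)) 𝓘(ℝ, ℝ × Space n) φ p).IsInvertible :=
  ⟨hφ.mdifferentiable.mfderiv hp, rfl⟩

theorem isInvertible_symm (hφ : IsSmoothChart φ) {x : ℝ × Space n} (hx : x ∈ φ.target) :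
    (mfderiv 𝓘(ℝ, ℝ × Space n) (𝓡 (n + 1)) φ.symm x).IsInvertible :=
  ⟨hφ.mdifferentiable.symm.mfderiv hx, rfl⟩

theorem chartDeriv_ofRep (hφ : IsSmoothChart φ) {p : M} (hp : p ∈ φ.source)
    (V : ℝ × Space n → ℝ × Space n) : chartDeriv φ p (ofRep φ V p) = V (φ p) :=
  (hφ.isInvertible hp).self_apply_inverse (V (φ p))

theorem rep_ofRep (hφ : IsSmoothChart φ) (V : ℝ × Space n → ℝ × Space n) {x : ℝ × Space n}
    (hx : x ∈ φ.target) : rep φ (ofRep φ V) x = V x := by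
  rw [rep, hφ.chartDeriv_ofRep (φ.map_target hx), φ.right_inv hx]

/-- Components can be read through the derivative of `φ` or as a pullback along `φ.symm`. The second
form gives access to smoothness of pullbacks and naturality of the Lie bracket. -/
theorem rep_eq_mpullback (hφ : IsSmoothChart φ) (X : VField n M) {x : ℝ × Space n}
    (hx : x ∈ φ.target) :
    rep φ X x = mpullback 𝓘(ℝ, ℝ × Space n) (𝓡 (n + 1)) φ.symm X x := by
  have h := hφ.mdifferentiable.symm_comp_deriv (φ.map_target hx)
  rw [φ.right_inv hx] at h
  exact ((hφ.isInvertible_symm hx).inverse_apply_eq.2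
    (DFunLike.congr_fun h (X (φ.symm x))).symm).symm

theorem diff_eq (hφ : IsSmoothChart φ) {x : ℝ × Space n} (hx : x ∈ φ.target) (f : M → ℝ)
    (w : TangentSpace (𝓡 (n + 1)) (φ.symm x)) :
    diff n f (φ.symm x) w = fderiv ℝ (f ∘ φ.symm) x (chartDeriv φ (φ.symm x) w) := by
  have hp := φ.map_target hx
  have hmd := hφ.mdifferentiable.mdifferentiableAt hp
  -- Nothing is assumed about `f`: where it is not differentiable, both derivatives have the default
  -- value zero.
  by_cases hd : DifferentiableAt ℝ (f ∘ φ.symm) x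
  · have hd' : MDifferentiableAt 𝓘(ℝ, ℝ × Space n) 𝓘(ℝ, ℝ) (f ∘ φ.symm) (φ (φ.symm x)) := by
      rw [φ.right_inv hx]
      exact hd.mdifferentiableAt
    have hEq : f =ᶠ[𝓝 (φ.symm x)] (f ∘ φ.symm) ∘ φ := by
      filter_upwards [φ.open_source.mem_nhds hp] with y hy
      simp [φ.left_inv hy]
    have h1 : mfderiv (𝓡 (n + 1)) 𝓘(ℝ, ℝ) f (φ.symm x)
        = mfderiv (𝓡 (n + 1)) 𝓘(ℝ, ℝ) ((f ∘ φ.symm) ∘ φ) (φ.symm x) := hEq.mfderiv_eq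
    have h2 := h1.trans (mfderiv_comp (φ.symm x) hd' hmd)
    rw [φ.right_inv hx, mfderiv_eq_fderiv] at h2
    exact DFunLike.congr_fun h2 w
  · have hd' : ¬ MDifferentiableAt (𝓡 (n + 1)) 𝓘(ℝ, ℝ) f (φ.symm x) := fun h ↦ hd
      (mdifferentiableAt_iff_differentiableAt.1
        (h.comp x (hφ.mdifferentiable.mdifferentiableAt_symm hx)))
    rw [diff, mfderiv_zero_of_not_mdifferentiableAt hd', fderiv_zero_of_not_differentiableAt hd]
    rfl

theorem contDiffAt_comp_symm (hφ : IsSmoothChart φ) {x : ℝ × Space n} (hx : x ∈ φ.target)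
    {f : M → ℝ} (hf : ContMDiffAt (𝓡 (n + 1)) 𝓘(ℝ, ℝ) ∞ f (φ.symm x)) :
    ContDiffAt ℝ ∞ (f ∘ φ.symm) x :=
  contMDiffAt_iff_contDiffAt.1 (hf.comp x (hφ.contMDiffAt_symm hx))

variable [IsManifold (𝓡 (n + 1)) ∞ M]

theorem smoothFieldAt_ofRep (hφ : IsSmoothChart φ) {p : M} (hp : p ∈ φ.source)
    {V : ℝ × Space n → ℝ × Space n} (hV : ContDiffAt ℝ ∞ V (φ p)) :
    SmoothFieldAt (ofRep φ V) p :=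
  ContMDiffAt.mpullback_vectorField_preimage (contMDiffAt_vectorSpace_iff_contDiffAt.2 hV)
    (hφ.contMDiffAt hp) (hφ.isInvertible hp) le_rfl

theorem contDiffAt_rep (hφ : IsSmoothChart φ) {x : ℝ × Space n} (hx : x ∈ φ.target)
    {X : VField n M} (hX : SmoothFieldAt X (φ.symm x)) : ContDiffAt ℝ ∞ (rep φ X) x := by
  have h : ContDiffAt ℝ ∞ (mpullback 𝓘(ℝ, ℝ × Space n) (𝓡 (n + 1)) φ.symm X) x :=
    contMDiffAt_vectorSpace_iff_contDiffAt.1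
      (ContMDiffAt.mpullback_vectorField_preimage hX (hφ.contMDiffAt_symm hx)
        (hφ.isInvertible_symm hx) le_rfl)
  refine h.congr_of_eventuallyEq ?_
  filter_upwards [φ.open_target.mem_nhds hx] with y hy using hφ.rep_eq_mpullback X hy

theorem rep_bracket (hφ : IsSmoothChart φ) {x : ℝ × Space n} (hx : x ∈ φ.target)
    {X Y : VField n M} (hX : SmoothFieldAt X (φ.symm x)) (hY : SmoothFieldAt Y (φ.symm x)) :
    rep φ (bracket X Y) x = lieBracket ℝ (rep φ X) (rep φ Y) x := by
  have : IsManifold (𝓡 (n + 1)) (minSmoothness ℝ 2) M := IsManifold.of_le (n := ∞) (by simpa using ENat.LEInfty.out)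
  have : IsManifold (𝓡 (n + 1)) (minSmoothness ℝ 3) M := IsManifold.of_le (n := ∞) (by simpa using ENat.LEInfty.out)
  rw [hφ.rep_eq_mpullback _ hx, bracket, mpullback_mlieBracket (hX.mdifferentiableAt (by simp))
    (hY.mdifferentiableAt (by simp)) (hφ.contMDiffAt_symm hx)
    (by simpa using ENat.LEInfty.out)]
  have h : ∀ X : VField n M,
      mpullback 𝓘(ℝ, ℝ × Space n) (𝓡 (n + 1)) φ.symm X =ᶠ[𝓝 x] rep φ X := fun X ↦ by
    filter_upwards [φ.open_target.mem_nhds hx] with y hy using (hφ.rep_eq_mpullback X hy).symm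
  refine (Filter.EventuallyEq.mlieBracket_vectorField_eq (h X) (h Y)).trans ?_
  exact mlieBracket_eq_lieBracket (rep φ X) (rep φ Y) x

end IsSmoothChart

end Coordinates

/-! ### Smooth 1-forms and their exterior derivative in coordinates -/

section Forms

variable {n : ℕ} {M : Type*} [TopologicalSpace M] [ChartedSpace (Model n) M]
  [IsManifold (𝓡 (n + 1)) ∞ M]

theorem contMDiffAt_form_apply {α : OneForm n M} {Y : VField n M} {U : Set M} (hU : IsOpen U)
    {p : M} (hp : p ∈ U) (hα : SmoothFormOn α U) (hY : SmoothFieldAt Y p) :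
    ContMDiffAt (𝓡 (n + 1)) 𝓘(ℝ, ℝ) ∞ (fun x ↦ α x (Y x)) p := by
  have h : ContMDiffAt (𝓡 (n + 1)) ((𝓡 (n + 1)).prod 𝓘(ℝ, ℝ)) ∞
      (fun m ↦ TotalSpace.mk' ℝ (E := Bundle.Trivial M ℝ) m (α m (Y m))) p := by
    apply ContMDiffAt.clm_bundle_apply (F₁ := Model n)
    · exact hα.contMDiffAt (hU.mem_nhds hp)
    · exact hY
  simp only [contMDiffAt_totalSpace] at h
  exact h.2

theorem smoothFormOn_diff {f : M → ℝ} {U : Set M} (hU : IsOpen U) (hf : SmoothFunOn n f U) :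
    SmoothFormOn (diff n f) U := by
  intro p hp
  have hfp : ContMDiffAt (𝓡 (n + 1)) 𝓘(ℝ, ℝ) ∞ f p := hf.contMDiffAt (hU.mem_nhds hp)
  have h := hfp.mfderiv_const (m := ∞) le_rfl
  refine ContMDiffAt.contMDiffWithinAt ?_
  rw [contMDiffAt_hom_bundle]
  refine ⟨contMDiffAt_id, h.congr_of_eventuallyEq ?_⟩
  refine Eventually.of_forall fun x ↦ ContinuousLinearMap.ext fun w ↦ ?_
  simp only [inTangentCoordinates, ContinuousLinearMap.inCoordinates, diff, id]
  simp
  rfl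

/-- The zero form is the differential of a constant function. -/
theorem smoothFormOn_zero (U : Set M) : SmoothFormOn (fun _ ↦ 0 : OneForm n M) U := by
  have h := smoothFormOn_diff (n := n) (f := fun _ : M ↦ (0 : ℝ)) isOpen_univ contMDiffOn_const
  refine (h.mono (subset_univ U)).congr fun x _ ↦ ?_
  have : diff n (fun _ : M ↦ (0 : ℝ)) x = 0 := mfderiv_const
  rw [this]

variable {φ : OpenPartialHomeomorph M (ℝ × Space n)}

/-- By the Leibniz rule the terms containing derivatives of `X` and `Y` add up to `A` applied to
their bracket, which the definition of `extDer` subtracts. Only the antisymmetrised derivative of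
the components survives. -/
theorem IsSmoothChart.extDer_eq (hφ : IsSmoothChart φ) {α : OneForm n M}
    {A : ℝ × Space n → (ℝ × Space n) →L[ℝ] ℝ}
    (hA : ∀ y ∈ φ.target, ∀ w, α (φ.symm y) w = A y (chartDeriv φ (φ.symm y) w))
    {x : ℝ × Space n} (hx : x ∈ φ.target) (hAd : DifferentiableAt ℝ A x) {X Y : VField n M}
    (hX : SmoothFieldAt X (φ.symm x)) (hY : SmoothFieldAt Y (φ.symm x)) :
    extDer α X Y (φ.symm x)
      = fderiv ℝ A x (rep φ X x) (rep φ Y x) - fderiv ℝ A x (rep φ Y x) (rep φ X x) := by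
  have key : ∀ Z : VField n M, SmoothFieldAt Z (φ.symm x) → ∀ w,
      fderiv ℝ ((fun q ↦ α q (Z q)) ∘ φ.symm) x w
        = fderiv ℝ A x w (rep φ Z x) + A x (fderiv ℝ (rep φ Z) x w) := by
    intro Z hZ w
    have hEq : (fun q ↦ α q (Z q)) ∘ φ.symm =ᶠ[𝓝 x] fun y ↦ A y (rep φ Z y) := by
      filter_upwards [φ.open_target.mem_nhds hx] with y hy using hA y hy _
    have hd := hAd.hasFDerivAt.clm_apply
      ((hφ.contDiffAt_rep hx hZ).differentiableAt (by simp)).hasFDerivAt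
    rw [hEq.fderiv_eq, hd.fderiv]
    simp [add_comm]
  have hb := hφ.rep_bracket hx hX hY
  rw [extDer, hφ.diff_eq hx, hφ.diff_eq hx, key X hX, key Y hY, hA x hx]
  rw [rep] at hb
  rw [hb, lieBracket, map_sub]
  simp only [rep]
  ring

end Forms

/-! ### Symmetric and antisymmetric parts of the covariant derivative; spacelike vectors -/

namespace LorentzianMetric

variable {n : ℕ} {M : Type*} [TopologicalSpace M] [ChartedSpace (Model n) M]
  [IsManifold (𝓡 (n + 1)) ∞ M] (g : LorentzianMetric n M)

theorem contMDiffAt_inn {X Y : VField n M} {p : M} (hX : SmoothFieldAt X p)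
    (hY : SmoothFieldAt Y p) : ContMDiffAt (𝓡 (n + 1)) 𝓘(ℝ, ℝ) ∞ (g.inn X Y) p := by
  have h : ContMDiffAt (𝓡 (n + 1)) ((𝓡 (n + 1)).prod 𝓘(ℝ, ℝ)) ∞
      (fun m ↦ TotalSpace.mk' ℝ (E := Bundle.Trivial M ℝ) m (g.val m (X m) (Y m))) p := by
    apply ContMDiffAt.clm_bundle_apply₂ (F₁ := Model n) (F₂ := Model n)
    · exact g.smooth.contMDiffAt
    · exact hX
    · exact hY
  simp only [contMDiffAt_totalSpace] at h
  exact h.2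

theorem inn_comm (X Y : VField n M) : g.inn X Y = g.inn Y X :=
  funext fun p ↦ g.symm p (X p) (Y p)

/-- The symmetric part of `∇ξ` is half the Lie derivative of the metric. -/
theorem nabla_add_swap (ξ X Y : VField n M) (p : M) :
    g.nabla ξ X Y p + g.nabla ξ Y X p = diff n (g.inn X Y) p (ξ p)
      - g.val p (bracket ξ X p) (Y p) - g.val p (X p) (bracket ξ Y p) := by
  have h1 : bracket X ξ p = - bracket ξ X p := mlieBracket_swap_apply
  have h2 : bracket Y ξ p = - bracket ξ Y p := mlieBracket_swap_apply
  have h3 : bracket Y X p = - bracket X Y p := mlieBracket_swap_apply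
  simp only [nabla, g.inn_comm Y X, g.inn_comm ξ X, g.inn_comm ξ Y, h1, h2, h3, map_neg,
    neg_apply, g.symm p (X p)]
  ring

/-- The antisymmetric part of `∇ξ` is half the exterior derivative of `ξ_i`. -/
theorem nabla_sub_swap (ξ X Y : VField n M) (p : M) :
    g.nabla ξ X Y p - g.nabla ξ Y X p = extDer (g.flat ξ) X Y p := by
  have h1 : bracket X ξ p = - bracket ξ X p := mlieBracket_swap_apply
  have h2 : bracket Y ξ p = - bracket ξ Y p := mlieBracket_swap_apply
  have h3 : bracket Y X p = - bracket X Y p := mlieBracket_swap_apply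
  have h4 : ∀ Z, (fun x ↦ g.flat ξ x (Z x)) = g.inn ξ Z := fun _ ↦ rfl
  have h5 : g.flat ξ p (bracket X Y p) = g.val p (bracket X Y p) (ξ p) := g.symm p _ _
  simp only [nabla, extDer, h4, h5, g.inn_comm Y X, g.inn_comm X ξ, g.inn_comm Y ξ, h1, h2, h3,
    map_neg, neg_apply]
  ring

/-- This recovers `∇ξ` from the Lie derivative of the metric and `dξ♭`, so no Christoffel symbols
are needed. -/
theorem nabla_eq_half (ξ X Y : VField n M) (p : M) :
    g.nabla ξ X Y p = ((g.nabla ξ X Y p + g.nabla ξ Y X p) + extDer (g.flat ξ) X Y p) / 2 := by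
  rw [← g.nabla_sub_swap]
  ring

/-- A vector orthogonal to a timelike vector is spacelike. -/
theorem pos_of_orthogonal_timelike {p : M} {u w : TangentSpace (𝓡 (n + 1)) p}
    (hu : g.val p u u < 0) (huw : g.val p u w = 0) (hw : w ≠ 0) : 0 < g.val p w w := by
  obtain ⟨v, -, hpos⟩ := g.lorentzian p
  by_contra! hle
  have hvu : g.val p v u ≠ 0 := fun h ↦ by
    have hu0 : u ≠ 0 := by
      rintro rfl
      simp at hu
    exact absurd (hpos u h hu0) hu.not_gt
  -- This combination of `u` and `w` is orthogonal to `v`, hence of positive square unless it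
  -- vanishes. As `u` and `w` are orthogonal, its square would be nonpositive if that of `w` were.
  have hz : g.val p v (g.val p v w • u - g.val p v u • w) = 0 := by
    simp only [map_sub, map_smul, smul_eq_mul]
    ring
  have hwu : g.val p w u = 0 := by rw [g.symm, huw]
  have hval : g.val p (g.val p v w • u - g.val p v u • w) (g.val p v w • u - g.val p v u • w)
      = (g.val p v w) ^ 2 * g.val p u u + (g.val p v u) ^ 2 * g.val p w w := by
    simp only [map_sub, map_smul, smul_eq_mul, sub_apply, smul_apply, huw, hwu]
    ring
  have hne : g.val p v w • u - g.val p v u • w ≠ 0 := fun h ↦ by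
    have h1 : g.val p u (g.val p v w • u - g.val p v u • w) = g.val p v w * g.val p u u := by
      simp only [map_sub, map_smul, smul_eq_mul, huw]
      ring
    rw [h, map_zero] at h1
    have h2 : g.val p v w = 0 := (mul_eq_zero.1 h1.symm).resolve_right hu.ne
    rw [h2, zero_smul, zero_sub, neg_eq_zero] at h
    exact (smul_ne_zero hvu hw) h
  have := hpos _ hz hne
  rw [hval] at this
  nlinarith [sq_nonneg (g.val p v w), sq_nonneg (g.val p v u)]

end LorentzianMetric

/-! ### The vector `a ∂_t` of a doubly warped metric -/

namespace LorentzianMetric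

variable {n : ℕ} {M : Type*} [TopologicalSpace M] [ChartedSpace (Model n) M]
  [IsManifold (𝓡 (n + 1)) ∞ M] {g : LorentzianMetric n M}

namespace IsDoublyWarpedChart

variable {φ : OpenPartialHomeomorph M (ℝ × Space n)} {a : ℝ → ℝ} {b : Space n → ℝ}
  {gs : Space n → (Space n →L[ℝ] Space n →L[ℝ] ℝ)}

theorem isSmoothChart (h : g.IsDoublyWarpedChart φ a b gs) : IsSmoothChart φ :=
  ⟨h.smooth_chart, h.smooth_symm⟩

theorem metric_chartDeriv (h : g.IsDoublyWarpedChart φ a b gs) {p : M} (hp : p ∈ φ.source)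
    (v w : TangentSpace (𝓡 (n + 1)) p) :
    g.val p v w = -(b (φ p).2) ^ 2 * ((chartDeriv φ p v).1 * (chartDeriv φ p w).1)
      + (a (φ p).1) ^ 2 * gs (φ p).2 (chartDeriv φ p v).2 (chartDeriv φ p w).2 :=
  h.metric_eq p hp v w

theorem contDiffAt_a (h : g.IsDoublyWarpedChart φ a b gs) {x : ℝ × Space n} (hx : x ∈ φ.target) :
    ContDiffAt ℝ ∞ a x.1 :=
  h.smooth_a.contDiffAt ((isOpenMap_fst _ φ.open_target).mem_nhds (mem_image_of_mem _ hx))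

theorem contDiffAt_b (h : g.IsDoublyWarpedChart φ a b gs) {x : ℝ × Space n} (hx : x ∈ φ.target) :
    ContDiffAt ℝ ∞ b x.2 :=
  h.smooth_b.contDiffAt ((isOpenMap_snd _ φ.open_target).mem_nhds (mem_image_of_mem _ hx))

theorem a_pos (h : g.IsDoublyWarpedChart φ a b gs) {x : ℝ × Space n} (hx : x ∈ φ.target) :
    0 < a x.1 :=
  h.pos_a _ (mem_image_of_mem _ hx)

theorem b_pos (h : g.IsDoublyWarpedChart φ a b gs) {x : ℝ × Space n} (hx : x ∈ φ.target) :
    0 < b x.2 :=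
  h.pos_b _ (mem_image_of_mem _ hx)

end IsDoublyWarpedChart

/-- The conformal Killing vector `a ∂_t` of a doubly warped spacetime. -/
def warpField (φ : OpenPartialHomeomorph M (ℝ × Space n)) (a : ℝ → ℝ) : VField n M :=
  ofRep φ fun x ↦ (a x.1, 0)

namespace IsDoublyWarpedChart

variable {φ : OpenPartialHomeomorph M (ℝ × Space n)} {a : ℝ → ℝ} {b : Space n → ℝ}
  {gs : Space n → (Space n →L[ℝ] Space n →L[ℝ] ℝ)}

theorem chartDeriv_warpField (h : g.IsDoublyWarpedChart φ a b gs) {p : M} (hp : p ∈ φ.source) :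
    chartDeriv φ p (warpField φ a p) = (a (φ p).1, 0) :=
  h.isSmoothChart.chartDeriv_ofRep hp _

theorem smoothFieldAt_warpField (h : g.IsDoublyWarpedChart φ a b gs) {p : M}
    (hp : p ∈ φ.source) : SmoothFieldAt (warpField φ a) p :=
  h.isSmoothChart.smoothFieldAt_ofRep hp
    (((h.contDiffAt_a (φ.map_source hp)).comp (φ p) contDiffAt_fst).prodMk contDiffAt_const)

theorem flat_warpField (h : g.IsDoublyWarpedChart φ a b gs) {p : M} (hp : p ∈ φ.source)
    (w : TangentSpace (𝓡 (n + 1)) p) :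
    g.flat (warpField φ a) p w = -(b (φ p).2) ^ 2 * a (φ p).1 * (chartDeriv φ p w).1 := by
  rw [flat, h.metric_chartDeriv hp, h.chartDeriv_warpField hp]
  simp only [map_zero, zero_apply]
  ring

/-- Both terms of the metric are rescaled by `2a'` along `a ∂_t`: the temporal one because `[a ∂_t,
∂_t] = -a' ∂_t`, the spatial one because `a ∂_t(a²) = 2a' a²`. -/
theorem nabla_add_swap_warpField (h : g.IsDoublyWarpedChart φ a b gs) {x : ℝ × Space n}
    (hx : x ∈ φ.target) {X Y : VField n M} (hX : SmoothFieldAt X (φ.symm x))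
    (hY : SmoothFieldAt Y (φ.symm x)) :
    g.nabla (warpField φ a) X Y (φ.symm x) + g.nabla (warpField φ a) Y X (φ.symm x)
      = 2 * deriv a x.1 * g.val (φ.symm x) (X (φ.symm x)) (Y (φ.symm x)) := by
  have hφ := h.isSmoothChart
  have hp := φ.map_target hx
  obtain ⟨t, q⟩ := x
  have ha : HasDerivAt a (deriv a t) t :=
    ((h.contDiffAt_a hx).differentiableAt (by simp)).hasDerivAt
  have hcurve : HasDerivAt (fun s : ℝ ↦ (s, q)) ((1 : ℝ), (0 : Space n)) t :=
    (hasDerivAt_id t).prodMk (hasDerivAt_const t q)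
  have hrep : ∀ {Z : VField n M}, SmoothFieldAt Z (φ.symm (t, q)) →
      HasFDerivAt (rep φ Z) (fderiv ℝ (rep φ Z) (t, q)) (t, q) := fun hZ ↦
    ((hφ.contDiffAt_rep hx hZ).differentiableAt (by simp)).hasFDerivAt
  have hrepc : ∀ {Z : VField n M}, SmoothFieldAt Z (φ.symm (t, q)) →
      HasDerivAt (fun s ↦ rep φ Z (s, q)) (fderiv ℝ (rep φ Z) (t, q) (1, 0)) t := fun hZ ↦
    HasFDerivAt.comp_hasDerivAt (f := fun s : ℝ ↦ (s, q)) t (hrep hZ) hcurve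
  have hrep1 : ∀ {Z : VField n M}, SmoothFieldAt Z (φ.symm (t, q)) →
      HasDerivAt (fun s ↦ (rep φ Z (s, q)).1) (fderiv ℝ (rep φ Z) (t, q) (1, 0)).1 t := fun hZ ↦
    (ContinuousLinearMap.fst ℝ ℝ (Space n)).hasFDerivAt.comp_hasDerivAt t (hrepc hZ)
  have hrep2 : ∀ {Z : VField n M}, SmoothFieldAt Z (φ.symm (t, q)) →
      HasDerivAt (fun s ↦ (rep φ Z (s, q)).2) (fderiv ℝ (rep φ Z) (t, q) (1, 0)).2 t := fun hZ ↦
    (ContinuousLinearMap.snd ℝ ℝ (Space n)).hasFDerivAt.comp_hasDerivAt t (hrepc hZ)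
  have hbr : ∀ {Z : VField n M}, SmoothFieldAt Z (φ.symm (t, q)) →
      chartDeriv φ (φ.symm (t, q)) (bracket (warpField φ a) Z (φ.symm (t, q)))
        = a t • fderiv ℝ (rep φ Z) (t, q) (1, 0) - (deriv a t * (rep φ Z (t, q)).1, 0) := by
    intro Z hZ
    have h1 := hφ.rep_bracket hx (h.smoothFieldAt_warpField hp) hZ
    have hV : rep φ (warpField φ a) =ᶠ[𝓝 (t, q)] fun x ↦ (a x.1, (0 : Space n)) := by
      filter_upwards [φ.open_target.mem_nhds hx] with y hy using hφ.rep_ofRep _ hy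
    have hVd : HasFDerivAt (fun x : ℝ × Space n ↦ (a x.1, (0 : Space n)))
        (((deriv a t) • ContinuousLinearMap.fst ℝ ℝ (Space n)).prod 0) (t, q) :=
      (ha.comp_hasFDerivAt (t, q) hasFDerivAt_fst).prodMk (hasFDerivAt_const _ _)
    rw [lieBracket, hV.fderiv_eq, hVd.fderiv, hV.eq_of_nhds] at h1
    rw [rep] at h1
    rw [h1]
    have h2 : (a t, (0 : Space n)) = a t • ((1 : ℝ), (0 : Space n)) := by simp
    rw [h2, map_smul]
    rfl
  have hEq : g.inn X Y ∘ φ.symm =ᶠ[𝓝 (t, q)] fun y ↦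
      -(b y.2) ^ 2 * ((rep φ X y).1 * (rep φ Y y).1)
        + (a y.1) ^ 2 * gs y.2 (rep φ X y).2 (rep φ Y y).2 := by
    filter_upwards [φ.open_target.mem_nhds hx] with y hy
    rw [Function.comp_apply, inn, h.metric_chartDeriv (φ.map_target hy), φ.right_inv hy]
    rfl
  have hdiff : HasFDerivAt (g.inn X Y ∘ φ.symm) (fderiv ℝ (g.inn X Y ∘ φ.symm) (t, q)) (t, q) :=
    ((hφ.contDiffAt_comp_symm hx (g.contMDiffAt_inn hX hY)).differentiableAt (by simp)).hasFDerivAt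
  -- Only the derivative along the line of fixed `q` enters, so `b` and `gs` act as constants;
  -- comparison with the product rule gives its value.
  have hline := HasFDerivAt.comp_hasDerivAt (f := fun s : ℝ ↦ (s, q)) t
    (hdiff.congr_of_eventuallyEq hEq.symm) hcurve
  have hgs : HasDerivAt (fun s ↦ gs q (rep φ X (s, q)).2 (rep φ Y (s, q)).2)
      (gs q (fderiv ℝ (rep φ X) (t, q) (1, 0)).2 (rep φ Y (t, q)).2
        + gs q (rep φ X (t, q)).2 (fderiv ℝ (rep φ Y) (t, q) (1, 0)).2) t :=
    ((gs q).hasFDerivAt.comp_hasDerivAt t (hrep2 hX)).clm_apply (hrep2 hY)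
  have hexpl := (((hrep1 hX).mul (hrep1 hY)).const_mul (-(b q) ^ 2)).add ((ha.pow 2).mul hgs)
  have hval := hline.unique hexpl
  rw [g.nabla_add_swap, hφ.diff_eq hx, h.chartDeriv_warpField hp, φ.right_inv hx,
    h.metric_chartDeriv hp, h.metric_chartDeriv hp, h.metric_chartDeriv hp, hbr hX, hbr hY,
    φ.right_inv hx]
  have h2 : (a t, (0 : Space n)) = a t • ((1 : ℝ), (0 : Space n)) := by simp
  simp only
  rw [h2, map_smul, hval]
  change _ = 2 * deriv a t * (-(b q) ^ 2 * ((rep φ X (t, q)).1 * (rep φ Y (t, q)).1)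
    + (a t) ^ 2 * gs q (rep φ X (t, q)).2 (rep φ Y (t, q)).2)
  have h3 : ∀ Z : VField n M, chartDeriv φ (φ.symm (t, q)) (Z (φ.symm (t, q))) = rep φ Z (t, q) :=
    fun _ ↦ rfl
  simp only [h3, Prod.fst_sub, Prod.snd_sub, Prod.smul_fst, Prod.smul_snd, sub_zero, map_smul,
    smul_eq_mul, smul_apply, Nat.cast_ofNat, Pi.pow_apply]
  ring

/-- Since `ξ♭ = -b² a dt`, the derivative of `a` contributes a multiple of `dt ∧ dt = 0`, and `-2ab
db ∧ dt` remains. -/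
theorem extDer_flat_warpField (h : g.IsDoublyWarpedChart φ a b gs) {x : ℝ × Space n}
    (hx : x ∈ φ.target) {X Y : VField n M} (hX : SmoothFieldAt X (φ.symm x))
    (hY : SmoothFieldAt Y (φ.symm x)) :
    extDer (g.flat (warpField φ a)) X Y (φ.symm x)
      = -2 * b x.2 * a x.1 * (fderiv ℝ b x.2 (rep φ X x).2 * (rep φ Y x).1
        - fderiv ℝ b x.2 (rep φ Y x).2 * (rep φ X x).1) := by
  have hb : HasFDerivAt (fun y : ℝ × Space n ↦ b y.2)
      ((fderiv ℝ b x.2).comp (ContinuousLinearMap.snd ℝ ℝ (Space n))) x :=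
    ((h.contDiffAt_b hx).differentiableAt (by simp)).hasFDerivAt.comp x hasFDerivAt_snd
  have ha : HasFDerivAt (fun y : ℝ × Space n ↦ a y.1)
      ((deriv a x.1) • ContinuousLinearMap.fst ℝ ℝ (Space n)) x :=
    ((h.contDiffAt_a hx).differentiableAt (by simp)).hasDerivAt.comp_hasFDerivAt x hasFDerivAt_fst
  have hψ := ((hb.pow 2).neg.mul ha).smul_const (ContinuousLinearMap.fst ℝ ℝ (Space n))
  rw [h.isSmoothChart.extDer_eq (A := fun y ↦ (-(b y.2) ^ 2 * a y.1) •
      ContinuousLinearMap.fst ℝ ℝ (Space n)) (fun y hy w ↦ ?_) hx hψ.differentiableAt hX hY]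
  · erw [hψ.fderiv]
    simp
    ring
  · rw [h.flat_warpField (φ.map_target hy), φ.right_inv hy]
    rfl

/-- The logarithm of the spatial scale function is smooth on the spacetime. -/
theorem contMDiffOn_log_b (h : g.IsDoublyWarpedChart φ a b gs) :
    SmoothFunOn n (fun p ↦ Real.log (b (φ p).2)) φ.source := by
  intro p hp
  have h1 : ContDiffAt ℝ ∞ (fun x : ℝ × Space n ↦ Real.log (b x.2)) (φ p) :=
    ((h.contDiffAt_b (φ.map_source hp)).comp (φ p) contDiffAt_snd).log
      (h.b_pos (φ.map_source hp)).ne'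
  exact (h1.contMDiffAt.comp p (h.isSmoothChart.contMDiffAt hp)).contMDiffWithinAt

theorem diff_log_b (h : g.IsDoublyWarpedChart φ a b gs) {x : ℝ × Space n} (hx : x ∈ φ.target)
    (w : TangentSpace (𝓡 (n + 1)) (φ.symm x)) :
    diff n (fun p ↦ Real.log (b (φ p).2)) (φ.symm x) w
      = fderiv ℝ (fun y : ℝ × Space n ↦ Real.log (b y.2)) x (chartDeriv φ (φ.symm x) w) := by
  rw [h.isSmoothChart.diff_eq hx]
  have : (fun p ↦ Real.log (b (φ p).2)) ∘ φ.symm =ᶠ[𝓝 x] fun y ↦ Real.log (b y.2) := by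
    filter_upwards [φ.open_target.mem_nhds hx] with y hy
    simp [φ.right_inv hy]
  rw [this.fderiv_eq]

theorem fderiv_log_b (h : g.IsDoublyWarpedChart φ a b gs) {x : ℝ × Space n} (hx : x ∈ φ.target)
    (u : ℝ × Space n) :
    fderiv ℝ (fun y : ℝ × Space n ↦ Real.log (b y.2)) x u = (b x.2)⁻¹ * fderiv ℝ b x.2 u.2 := by
  have hb : HasFDerivAt (fun y : ℝ × Space n ↦ b y.2)
      ((fderiv ℝ b x.2).comp (ContinuousLinearMap.snd ℝ ℝ (Space n))) x :=
    ((h.contDiffAt_b hx).differentiableAt (by simp)).hasFDerivAt.comp x hasFDerivAt_snd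
  rw [(hb.log (h.b_pos hx).ne').fderiv]
  simp

/-- In coordinates this is the symmetry of second derivatives. -/
theorem closedOn_diff_log_b (h : g.IsDoublyWarpedChart φ a b gs) :
    ClosedOn (diff n (fun p ↦ Real.log (b (φ p).2))) φ.source := by
  intro p hp X Y hX hY
  have hx := φ.map_source hp
  have hs : ContDiffAt ℝ ∞ (fun x : ℝ × Space n ↦ Real.log (b x.2)) (φ p) :=
    ((h.contDiffAt_b hx).comp (φ p) contDiffAt_snd).log (h.b_pos hx).ne'
  rw [← φ.left_inv hp] at hX hY ⊢
  rw [h.isSmoothChart.extDer_eq (fun y hy w ↦ h.diff_log_b hy w) hx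
    ((hs.fderiv_right (m := ∞) le_rfl).differentiableAt (by simp)) hX hY,
    (hs.isSymmSndFDerivAt (by simpa using ENat.LEInfty.out)).eq, sub_self]

/-- The symmetric part of `∇ξ` is `a' g`, and `dξ♭ = 2 d(log b) ∧ ξ♭` gives the antisymmetric one.
As `b` does not depend on `t`, `d(log b)` vanishes on `a ∂_t`. -/
theorem associatedFormOn_warpField (h : g.IsDoublyWarpedChart φ a b gs) :
    g.AssociatedFormOn (warpField φ a) (fun p ↦ deriv a (φ p).1)
      (diff n (fun p ↦ Real.log (b (φ p).2))) φ.source := by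
  refine ⟨smoothFormOn_diff φ.open_source h.contMDiffOn_log_b, fun p hp ↦ ?_,
    fun p hp X Y hX hY ↦ ?_⟩
  · obtain ⟨x, hx, rfl⟩ : ∃ x ∈ φ.target, φ.symm x = p := ⟨φ p, φ.map_source hp, φ.left_inv hp⟩
    rw [h.diff_log_b hx, h.fderiv_log_b hx, h.chartDeriv_warpField hp, map_zero, mul_zero]
  · obtain ⟨x, hx, rfl⟩ : ∃ x ∈ φ.target, φ.symm x = p := ⟨φ p, φ.map_source hp, φ.left_inv hp⟩
    have hb := (h.b_pos hx).ne'
    rw [g.nabla_eq_half, h.nabla_add_swap_warpField hx hX hY, h.extDer_flat_warpField hx hX hY,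
      h.diff_log_b hx, h.diff_log_b hx, h.fderiv_log_b hx, h.fderiv_log_b hx,
      h.flat_warpField hp, h.flat_warpField hp, φ.right_inv hx]
    simp only [rep, φ.right_inv hx]
    field_simp
    ring

/-- The square of `a ∂_t` is `-a² b²`, and `ξ♭ = -b² a dt` is a multiple of the differential of the
time coordinate. -/
theorem isTHOCKV_warpField (h : g.IsDoublyWarpedChart φ a b gs) :
    g.IsTHOCKV (warpField φ a) (fun p ↦ deriv a (φ p).1) φ.source where
  timelike p hp := by
    have h1 := h.flat_warpField hp (warpField φ a p)
    rw [h.chartDeriv_warpField hp] at h1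
    have h2 := h.a_pos (φ.map_source hp)
    have h3 := h.b_pos (φ.map_source hp)
    have h4 : g.val p (warpField φ a p) (warpField φ a p)
        = -((b (φ p).2) ^ 2 * a (φ p).1 * a (φ p).1) := by
      refine Eq.trans h1 ?_
      ring
    rw [h4, neg_lt_zero]
    positivity
  conformalKilling := by
    refine ⟨fun p hp ↦ (h.smoothFieldAt_warpField hp).contMDiffWithinAt, fun p hp ↦ ?_,
      fun p hp X Y hX hY ↦ ?_⟩
    · have h1 : ContDiffAt ℝ ∞ (deriv a) (φ p).1 :=
        ((h.contDiffAt_a (φ.map_source hp)).derivWithin le_rfl)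
      exact ((h1.comp (φ p) contDiffAt_fst).contMDiffAt.comp p
        (h.isSmoothChart.contMDiffAt hp)).contMDiffWithinAt
    · obtain ⟨x, hx, rfl⟩ : ∃ x ∈ φ.target, φ.symm x = p := ⟨φ p, φ.map_source hp, φ.left_inv hp⟩
      simp only [h.nabla_add_swap_warpField hx hX hY, φ.right_inv hx]
  hypersurfaceOrthogonal p hp := by
    refine ⟨φ.source, φ.open_source, hp, Subset.rfl, fun p ↦ -(b (φ p).2) ^ 2 * a (φ p).1,
      fun p ↦ (φ p).1, fun q hq ↦ ?_, fun q hq ↦ ?_, fun q hq ↦ ?_⟩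
    · have hx := φ.map_source hq
      have h1 : ContDiffAt ℝ ∞ (fun x : ℝ × Space n ↦ -(b x.2) ^ 2 * a x.1) (φ q) :=
        (((h.contDiffAt_b hx).comp (φ q) contDiffAt_snd).pow 2).neg.mul
          ((h.contDiffAt_a hx).comp (φ q) contDiffAt_fst)
      exact (h1.contMDiffAt.comp q (h.isSmoothChart.contMDiffAt hq)).contMDiffWithinAt
    · have h1 : ContDiffAt ℝ ∞ (fun x : ℝ × Space n ↦ x.1) (φ q) := contDiffAt_fst
      exact (h1.contMDiffAt.comp q (h.isSmoothChart.contMDiffAt hq)).contMDiffWithinAt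
    · obtain ⟨x, hx, rfl⟩ : ∃ x ∈ φ.target, φ.symm x = q := ⟨φ q, φ.map_source hq, φ.left_inv hq⟩
      have h1 : ∀ w, diff n (fun p ↦ (φ p).1) (φ.symm x) w
          = (chartDeriv φ (φ.symm x) w).1 := by
        intro w
        rw [h.isSmoothChart.diff_eq hx]
        have : (fun p ↦ (φ p).1) ∘ φ.symm =ᶠ[𝓝 x] fun y ↦ y.1 := by
          filter_upwards [φ.open_target.mem_nhds hx] with y hy
          simp [φ.right_inv hy]
        rw [this.fderiv_eq, hasFDerivAt_fst.fderiv]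
        rfl
      refine ⟨fun h0 ↦ ?_, ContinuousLinearMap.ext fun w ↦ ?_⟩
      · obtain ⟨w, hw⟩ := h.isSmoothChart.chartDeriv_surjective hq (1, 0)
        have h2 := h1 w
        rw [h0, hw] at h2
        exact zero_ne_one h2
      · rw [h.flat_warpField hq]
        change _ = _ * (diff n (fun p ↦ (φ p).1) (φ.symm x) w)
        rw [h1]

/-- Both forms are multiples of `dt`: `dκ = a'' dt` and `ξ♭ = -b² a dt`, so `c = -a'' / (b² a)`. -/
theorem diff_deriv_a (h : g.IsDoublyWarpedChart φ a b gs) {p : M} (hp : p ∈ φ.source) :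
    ∃ c : ℝ, diff n (fun p ↦ deriv a (φ p).1) p = c • g.flat (warpField φ a) p := by
  obtain ⟨x, hx, rfl⟩ : ∃ x ∈ φ.target, φ.symm x = p := ⟨φ p, φ.map_source hp, φ.left_inv hp⟩
  have ha := (h.a_pos hx).ne'
  have hb := (h.b_pos hx).ne'
  refine ⟨-(deriv (deriv a) x.1) / ((b x.2) ^ 2 * a x.1), ContinuousLinearMap.ext fun w ↦ ?_⟩
  have h1 : ContDiffAt ℝ ∞ (deriv a) x.1 :=
    ((h.contDiffAt_a hx).derivWithin le_rfl)
  have h2 : HasFDerivAt (fun y : ℝ × Space n ↦ deriv a y.1)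
      (deriv (deriv a) x.1 • ContinuousLinearMap.fst ℝ ℝ (Space n)) x :=
    (h1.differentiableAt (by simp)).hasDerivAt.comp_hasFDerivAt x hasFDerivAt_fst
  have h3 : (fun p ↦ deriv a (φ p).1) ∘ φ.symm =ᶠ[𝓝 x] fun y ↦ deriv a y.1 := by
    filter_upwards [φ.open_target.mem_nhds hx] with y hy
    simp [φ.right_inv hy]
  rw [h.isSmoothChart.diff_eq hx, h3.fderiv_eq, h2.fderiv]
  change _ = _ * g.flat (warpField φ a) (φ.symm x) w
  rw [h.flat_warpField hp, φ.right_inv hx]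
  simp only [smul_apply, ContinuousLinearMap.coe_fst', smul_eq_mul]
  field_simp

end IsDoublyWarpedChart

/-- On the whole domain of doubly warped coordinates there is a conformal Killing vector with
closed associated form. -/
theorem DoublyWarpedOn.hasClosedTHOCKV {U : Set M} (h : g.DoublyWarpedOn U) :
    g.HasClosedTHOCKV U := by
  obtain ⟨φ, a, b, gs, rfl, h⟩ := h
  exact ⟨_, _, _, h.isTHOCKV_warpField, h.associatedFormOn_warpField, h.closedOn_diff_log_b⟩

/-- On the whole domain of doubly warped coordinates there is a conformal Killing vector parallel
to the gradient of its conformal function. -/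
theorem DoublyWarpedOn.hasParallelTHOCKV {U : Set M} (h : g.DoublyWarpedOn U) :
    g.HasParallelTHOCKV U := by
  obtain ⟨φ, a, b, gs, rfl, h⟩ := h
  exact ⟨_, _, h.isTHOCKV_warpField, fun p hp ↦ h.diff_deriv_a hp⟩

end LorentzianMetric

/-! ### Charts adapted to a vector field -/

section AdaptedCharts

variable {n : ℕ} {M : Type*} [TopologicalSpace M] [ChartedSpace (Model n) M]
  {φ : OpenPartialHomeomorph M (ℝ × Space n)}

theorem IsSmoothChart.trans (hφ : IsSmoothChart φ)
    {Ψ : OpenPartialHomeomorph (ℝ × Space n) (ℝ × Space n)}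
    (hΨ : ContDiffOn ℝ ∞ Ψ Ψ.source) (hΨs : ContDiffOn ℝ ∞ Ψ.symm Ψ.target) :
    IsSmoothChart (φ.trans Ψ) where
  smooth := by
    refine hΨ.contMDiffOn.comp (hφ.smooth.mono fun p hp ↦ ?_) fun p hp ↦ ?_
    · rw [OpenPartialHomeomorph.trans_source] at hp
      exact hp.1
    · rw [OpenPartialHomeomorph.trans_source] at hp
      exact hp.2
  smooth_symm := by
    refine hφ.smooth_symm.comp (hΨs.contMDiffOn.mono fun p hp ↦ ?_) fun p hp ↦ ?_
    · rw [OpenPartialHomeomorph.trans_target] at hp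
      exact hp.1
    · rw [OpenPartialHomeomorph.trans_target] at hp
      exact hp.2

theorem IsSmoothChart.chartDeriv_trans (hφ : IsSmoothChart φ)
    {Ψ : OpenPartialHomeomorph (ℝ × Space n) (ℝ × Space n)} (hΨ : ContDiffOn ℝ ∞ Ψ Ψ.source)
    {p : M} (hp : p ∈ (φ.trans Ψ).source) (w : TangentSpace (𝓡 (n + 1)) p) :
    chartDeriv (φ.trans Ψ) p w = fderiv ℝ Ψ (φ p) (chartDeriv φ p w) := by
  rw [OpenPartialHomeomorph.trans_source] at hp
  have hd : DifferentiableAt ℝ Ψ (φ p) :=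
    (hΨ.contDiffAt (Ψ.open_source.mem_nhds hp.2)).differentiableAt (by simp)
  have h := mfderiv_comp p hd.mdifferentiableAt (hφ.mdifferentiable.mdifferentiableAt hp.1)
  rw [mfderiv_eq_fderiv] at h
  exact DFunLike.congr_fun h w

/-- The coordinate vector field in the constant direction `w`. -/
def coordField (φ : OpenPartialHomeomorph M (ℝ × Space n)) (w : ℝ × Space n) : VField n M :=
  ofRep φ fun _ ↦ w

theorem IsSmoothChart.coordField_symm (hφ : IsSmoothChart φ) {x : ℝ × Space n} (hx : x ∈ φ.target)
    (w : ℝ × Space n) : coordField φ w (φ.symm x) = chartSymmDeriv φ x w := by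
  refine hφ.chartDeriv_injective (φ.map_target hx) ?_
  rw [hφ.chartDeriv_symm hx]
  exact hφ.chartDeriv_ofRep (φ.map_target hx) _

theorem IsSmoothChart.chartDeriv_coordField (hφ : IsSmoothChart φ) {p : M} (hp : p ∈ φ.source)
    (w : ℝ × Space n) : chartDeriv φ p (coordField φ w p) = w :=
  hφ.chartDeriv_ofRep hp _

variable [IsManifold (𝓡 (n + 1)) ∞ M]

theorem exists_isSmoothChart (p : M) :
    ∃ φ : OpenPartialHomeomorph M (ℝ × Space n), IsSmoothChart φ ∧ p ∈ φ.source := by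
  have hdim : Module.finrank ℝ (Model n) = Module.finrank ℝ (ℝ × Space n) := by
    rw [Module.finrank_prod, Module.finrank_self, finrank_euclideanSpace_fin,
      finrank_euclideanSpace_fin, add_comm]
  let L : Model n ≃L[ℝ] (ℝ × Space n) := ContinuousLinearEquiv.ofFinrankEq hdim
  refine ⟨(chartAt (Model n) p).trans L.toHomeomorph.toOpenPartialHomeomorph, ⟨?_, ?_⟩, ?_⟩
  · refine L.contDiff.contMDiff.comp_contMDiffOn ((contMDiffOn_chart (x := p)).mono ?_)
    simp
  · refine (contMDiffOn_chart_symm (x := p)).comp L.symm.contDiff.contMDiff.contMDiffOn ?_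
    intro x hx
    simpa using hx
  · simp

/-- Coordinates in which `ξ` is the first coordinate vector field, on the product of two balls. -/
structure IsAdaptedChart (φ : OpenPartialHomeomorph M (ℝ × Space n)) (ξ : VField n M)
    (ε : ℝ) : Prop where
  isSmoothChart : IsSmoothChart φ
  pos : 0 < ε
  target_eq : φ.target = Metric.ball (0 : ℝ) ε ×ˢ Metric.ball (0 : Space n) ε
  chartDeriv_eq : ∀ p ∈ φ.source, chartDeriv φ p (ξ p) = (1, 0)

/-- This is the straightening theorem read in an arbitrary chart; the level set of `h` through `p`
becomes the slice `s = 0`. -/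
theorem exists_isAdaptedChart {V : Set M} (hV : IsOpen V) {p : M} (hp : p ∈ V) {ξ : VField n M}
    (hξ : SmoothFieldOn ξ V) {h : M → ℝ} (hh : SmoothFunOn n h V) (htr : diff n h p (ξ p) ≠ 0) :
    ∃ (φ : OpenPartialHomeomorph M (ℝ × Space n)) (ε : ℝ), IsAdaptedChart φ ξ ε ∧ p ∈ φ.source ∧
      φ.source ⊆ V ∧ ∀ q ∈ Metric.ball (0 : Space n) ε, h (φ.symm (0, q)) = h p := by
  obtain ⟨φ₀, hφ₀, hp₀⟩ := exists_isSmoothChart (n := n) p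
  have hx₀ := φ₀.map_source hp₀
  have hΩ : IsOpen (φ₀.target ∩ φ₀.symm ⁻¹' V) :=
    φ₀.continuousOn_symm.isOpen_inter_preimage φ₀.open_target hV
  have hE : Module.finrank ℝ (ℝ × Space n) = n + 1 := by
    rw [Module.finrank_prod, Module.finrank_self, finrank_euclideanSpace_fin, add_comm]
  have hv : ContDiffOn ℝ ∞ (rep φ₀ ξ) (φ₀.target ∩ φ₀.symm ⁻¹' V) := fun x hx ↦
    (hφ₀.contDiffAt_rep hx.1 (hξ.contMDiffAt (hV.mem_nhds hx.2))).contDiffWithinAt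
  have hh₀ : ContDiffOn ℝ ∞ (h ∘ φ₀.symm) (φ₀.target ∩ φ₀.symm ⁻¹' V) := fun x hx ↦
    (hφ₀.contDiffAt_comp_symm hx.1 (hh.contMDiffAt (hV.mem_nhds hx.2))).contDiffWithinAt
  have htr₀ : fderiv ℝ (h ∘ φ₀.symm) (φ₀ p) (rep φ₀ ξ (φ₀ p)) ≠ 0 := by
    rw [rep, ← hφ₀.diff_eq hx₀, φ₀.left_inv hp₀]
    exact htr
  obtain ⟨Ψ, ε, hε, hsrc, htgt, hΨ0, hΨ, hΨs, hder, hlev⟩ := exists_straightening hE hΩ hv hh₀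
    (x₀ := φ₀ p) ⟨hx₀, by rwa [mem_preimage, φ₀.left_inv hp₀]⟩ htr₀
  have h00 : ((0 : ℝ), (0 : Space n)) ∈ Ψ.source := by
    rw [hsrc]
    exact ⟨Metric.mem_ball_self hε, Metric.mem_ball_self hε⟩
  have hT : IsSmoothChart (φ₀.trans Ψ.symm) := hφ₀.trans hΨs hΨ
  have hs : ∀ x ∈ (φ₀.trans Ψ.symm).source, x ∈ φ₀.source ∧ φ₀ x ∈ Ψ.target := fun x hx ↦ by
    rwa [OpenPartialHomeomorph.trans_source] at hx
  refine ⟨φ₀.trans Ψ.symm, ε, ⟨hT, hε, ?_, fun x hx ↦ ?_⟩, ?_, fun x hx ↦ ?_, fun q hq ↦ ?_⟩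
  · rw [OpenPartialHomeomorph.trans_target, ← hsrc]
    refine inter_eq_left.2 fun y hy ↦ ?_
    exact (htgt (Ψ.map_source hy)).1
  · obtain ⟨hx1, hx2⟩ := hs x hx
    rw [hφ₀.chartDeriv_trans hΨs hx]
    have hz := Ψ.map_target hx2
    have h1 := hder _ hz
    rw [Ψ.right_inv hx2, rep, φ₀.left_inv hx1] at h1
    rw [← h1]
    have hd1 : HasFDerivAt Ψ (fderiv ℝ Ψ (Ψ.symm (φ₀ x))) (Ψ.symm (φ₀ x)) :=
      ((hΨ.contDiffAt (Ψ.open_source.mem_nhds hz)).differentiableAt (by simp)).hasFDerivAt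
    have hd2 : HasFDerivAt Ψ.symm (fderiv ℝ Ψ.symm (φ₀ x)) (Ψ (Ψ.symm (φ₀ x))) := by
      rw [Ψ.right_inv hx2]
      exact ((hΨs.contDiffAt (Ψ.open_target.mem_nhds hx2)).differentiableAt (by simp)).hasFDerivAt
    have hd3 := hd2.comp _ hd1
    -- Differentiating this identity turns `DΨ(1, 0) = ξ` into the statement that the derivative of
    -- the new chart sends `ξ` to `(1, 0)`.
    have hid : Ψ.symm ∘ Ψ =ᶠ[𝓝 (Ψ.symm (φ₀ x))] id := by
      filter_upwards [Ψ.open_source.mem_nhds hz] with y hy using Ψ.left_inv hy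
    have h2 := hd3.unique ((hasFDerivAt_id _).congr_of_eventuallyEq hid)
    exact DFunLike.congr_fun h2 (1, 0)
  · rw [OpenPartialHomeomorph.trans_source]
    exact ⟨hp₀, by
      change φ₀ p ∈ Ψ.target
      rw [← hΨ0]
      exact Ψ.map_source h00⟩
  · obtain ⟨hx1, hx2⟩ := hs x hx
    have := (htgt hx2).2
    rwa [mem_preimage, φ₀.left_inv hx1] at this
  · have := hlev q hq
    rwa [Function.comp_apply, Function.comp_apply, φ₀.left_inv hp₀] at this

namespace IsSmoothChart

theorem smoothFieldAt_coordField (hφ : IsSmoothChart φ) {p : M} (hp : p ∈ φ.source)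
    (w : ℝ × Space n) : SmoothFieldAt (coordField φ w) p :=
  hφ.smoothFieldAt_ofRep hp contDiffAt_const

theorem bracket_eq_zero (hφ : IsSmoothChart φ) {x : ℝ × Space n} (hx : x ∈ φ.target)
    {X Y : VField n M} (hX : SmoothFieldAt X (φ.symm x)) (hY : SmoothFieldAt Y (φ.symm x))
    {v w : ℝ × Space n} (hXc : ∀ p ∈ φ.source, chartDeriv φ p (X p) = v)
    (hYc : ∀ p ∈ φ.source, chartDeriv φ p (Y p) = w) : bracket X Y (φ.symm x) = 0 := by
  have h := hφ.rep_bracket hx hX hY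
  have hXe : rep φ X =ᶠ[𝓝 x] fun _ ↦ v := by
    filter_upwards [φ.open_target.mem_nhds hx] with y hy using hXc _ (φ.map_target hy)
  have hYe : rep φ Y =ᶠ[𝓝 x] fun _ ↦ w := by
    filter_upwards [φ.open_target.mem_nhds hx] with y hy using hYc _ (φ.map_target hy)
  rw [lieBracket, hXe.fderiv_eq, hYe.fderiv_eq, fderiv_const_apply, fderiv_const_apply] at h
  refine hφ.chartDeriv_injective (φ.map_target hx) ?_
  rw [map_zero]
  simpa [rep] using h

end IsSmoothChart

/-- The components of the metric in the coordinates `φ`. -/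
def LorentzianMetric.metricRep (g : LorentzianMetric n M)
    (φ : OpenPartialHomeomorph M (ℝ × Space n)) (x : ℝ × Space n) :
    (ℝ × Space n) →L[ℝ] (ℝ × Space n) →L[ℝ] ℝ :=
  ContinuousLinearMap.bilinearComp (E := Model n) (F := Model n) (g.val (φ.symm x))
    (chartSymmDeriv φ x) (chartSymmDeriv φ x)

variable (g : LorentzianMetric n M)

theorem LorentzianMetric.metricRep_apply (x v w : ℝ × Space n) : g.metricRep φ x v w
    = g.val (φ.symm x) (chartSymmDeriv φ x v) (chartSymmDeriv φ x w) := rfl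

theorem LorentzianMetric.metricRep_comm (x v w : ℝ × Space n) :
    g.metricRep φ x v w = g.metricRep φ x w v :=
  g.symm _ _ _

namespace IsSmoothChart

theorem inn_coordField (hφ : IsSmoothChart φ) {x : ℝ × Space n} (hx : x ∈ φ.target)
    (v w : ℝ × Space n) :
    g.inn (coordField φ v) (coordField φ w) (φ.symm x) = g.metricRep φ x v w := by
  rw [LorentzianMetric.inn, hφ.coordField_symm hx, hφ.coordField_symm hx, g.metricRep_apply]

theorem val_eq_metricRep (hφ : IsSmoothChart φ) {p : M} (hp : p ∈ φ.source)
    (v w : TangentSpace (𝓡 (n + 1)) p) :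
    g.val p v w = g.metricRep φ (φ p) (chartDeriv φ p v) (chartDeriv φ p w) := by
  obtain ⟨x, hx, rfl⟩ : ∃ x ∈ φ.target, φ.symm x = p := ⟨φ p, φ.map_source hp, φ.left_inv hp⟩
  have h : ∀ v, chartSymmDeriv φ x (chartDeriv φ (φ.symm x) v) = v := fun v ↦
    hφ.chartDeriv_injective hp (hφ.chartDeriv_symm hx _)
  rw [φ.right_inv hx, g.metricRep_apply, h, h]

/-- In finite dimension it suffices to evaluate on fixed vectors, and then the components are inner
products of smooth coordinate fields. -/
theorem contDiffOn_metricRep (hφ : IsSmoothChart φ) :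
    ContDiffOn ℝ ∞ (g.metricRep φ) φ.target := by
  refine contDiffOn_clm_apply.2 fun v ↦ contDiffOn_clm_apply.2 fun w ↦ fun x hx ↦ ?_
  have hp := φ.map_target hx
  refine (ContDiffAt.congr_of_eventuallyEq (hφ.contDiffAt_comp_symm hx
    (g.contMDiffAt_inn (hφ.smoothFieldAt_coordField hp v)
      (hφ.smoothFieldAt_coordField hp w))) ?_).contDiffWithinAt
  filter_upwards [φ.open_target.mem_nhds hx] with y hy using (hφ.inn_coordField g hy v w).symm

end IsSmoothChart

end AdaptedCharts

/-! ### Constancy on balls and proportional solutions of linear equations -/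

theorem eq_of_fderiv_eq_zero_on_ball {E : Type*} [NormedAddCommGroup E] [NormedSpace ℝ E] {ε : ℝ}
    (hε : 0 < ε) {f : E → ℝ} {f' : E → E →L[ℝ] ℝ}
    (hf : ∀ q ∈ Metric.ball (0 : E) ε, HasFDerivAt f (f' q) q)
    (h0 : ∀ q ∈ Metric.ball (0 : E) ε, ∀ w, f' q w = 0) {q : E} (hq : q ∈ Metric.ball (0 : E) ε) :
    f q = f 0 :=
  Metric.isOpen_ball.is_const_of_fderiv_eq_zero (convex_ball _ _).isPreconnected
    (fun y hy ↦ (hf y hy).differentiableAt.differentiableWithinAt)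
    (fun y hy ↦ by
      rw [(hf y hy).fderiv]
      exact ContinuousLinearMap.ext (h0 y hy)) hq (Metric.mem_ball_self hε)

theorem eq_of_deriv_eq_zero_on_ball {ε : ℝ} (hε : 0 < ε) {f f' : ℝ → ℝ}
    (hf : ∀ s ∈ Metric.ball (0 : ℝ) ε, HasDerivAt f (f' s) s)
    (h0 : ∀ s ∈ Metric.ball (0 : ℝ) ε, f' s = 0) {s : ℝ} (hs : s ∈ Metric.ball (0 : ℝ) ε) :
    f s = f 0 :=
  eq_of_fderiv_eq_zero_on_ball hε (fun y hy ↦ (hf y hy).hasFDerivAt)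
    (fun y hy w ↦ by simp [h0 y hy]) hs

/-- Two nonvanishing solutions of the same linear differential equation are proportional. -/
theorem mul_eq_mul_of_hasDerivAt {ε : ℝ} (hε : 0 < ε) {u v k : ℝ → ℝ}
    (hu : ∀ s ∈ Metric.ball (0 : ℝ) ε, HasDerivAt u (k s * u s) s)
    (hv : ∀ s ∈ Metric.ball (0 : ℝ) ε, HasDerivAt v (k s * v s) s)
    (hv0 : ∀ s ∈ Metric.ball (0 : ℝ) ε, v s ≠ 0) {s : ℝ} (hs : s ∈ Metric.ball (0 : ℝ) ε) :
    u s * v 0 = u 0 * v s := by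
  have h := eq_of_deriv_eq_zero_on_ball hε (f := fun s ↦ u s / v s)
    (fun r hr ↦ (hu r hr).div (hv r hr) (hv0 r hr)) (fun r hr ↦ by
      rw [div_eq_zero_iff]
      left
      ring) hs
  exact (div_eq_div_iff (hv0 s hs) (hv0 0 (Metric.mem_ball_self hε))).1 h

/-! ### Fields in adapted charts -/

section AdaptedCharts

variable {n : ℕ} {M : Type*} [TopologicalSpace M] [ChartedSpace (Model n) M] {ξ : VField n M}
  {φ : OpenPartialHomeomorph M (ℝ × Space n)} {ε : ℝ}

namespace IsAdaptedChart

theorem mem_target (hφ : IsAdaptedChart φ ξ ε) {s : ℝ} {q : Space n}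
    (hs : s ∈ Metric.ball (0 : ℝ) ε) (hq : q ∈ Metric.ball (0 : Space n) ε) :
    (s, q) ∈ φ.target := by
  rw [hφ.target_eq]
  exact ⟨hs, hq⟩

theorem chartSymmDeriv_eq (hφ : IsAdaptedChart φ ξ ε) {x : ℝ × Space n} (hx : x ∈ φ.target) :
    chartSymmDeriv φ x (1, 0) = ξ (φ.symm x) := by
  refine hφ.isSmoothChart.chartDeriv_injective (φ.map_target hx) ?_
  rw [hφ.isSmoothChart.chartDeriv_symm hx, hφ.chartDeriv_eq _ (φ.map_target hx)]

theorem coordField_eq (hφ : IsAdaptedChart φ ξ ε) {p : M} (hp : p ∈ φ.source) :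
    coordField φ (1, 0) p = ξ p := by
  refine hφ.isSmoothChart.chartDeriv_injective hp ?_
  rw [hφ.isSmoothChart.chartDeriv_coordField hp, hφ.chartDeriv_eq p hp]

end IsAdaptedChart

end AdaptedCharts

/-! ### The metric in coordinates adapted to a conformal Killing vector -/

section ConformalCharts

variable {n : ℕ} {M : Type*} [TopologicalSpace M] [ChartedSpace (Model n) M]
  [IsManifold (𝓡 (n + 1)) ∞ M] {g : LorentzianMetric n M} {ξ : VField n M} {κ : M → ℝ} {U : Set M}
  {φ : OpenPartialHomeomorph M (ℝ × Space n)} {ε : ℝ}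

theorem LorentzianMetric.IsTHOCKV.mono (h : g.IsTHOCKV ξ κ U) {V : Set M} (hV : IsOpen V)
    (hVU : V ⊆ U) : g.IsTHOCKV ξ κ V where
  timelike p hp := h.timelike p (hVU hp)
  conformalKilling := ⟨h.conformalKilling.1.mono hVU, h.conformalKilling.2.1.mono hVU,
    fun p hp ↦ h.conformalKilling.2.2 p (hVU hp)⟩
  hypersurfaceOrthogonal p hp := by
    obtain ⟨W, hW, hpW, -, f, k, hf, hk, hfk⟩ := h.hypersurfaceOrthogonal p (hVU hp)
    exact ⟨W ∩ V, hW.inter hV, ⟨hpW, hp⟩, inter_subset_right, f, k, hf.mono inter_subset_left,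
      hk.mono inter_subset_left, fun x hx ↦ hfk x hx.1⟩

namespace IsAdaptedChart

theorem flat_coordField (hφ : IsAdaptedChart φ ξ ε) {x : ℝ × Space n} (hx : x ∈ φ.target)
    (w : ℝ × Space n) :
    g.flat ξ (φ.symm x) (coordField φ w (φ.symm x)) = g.metricRep φ x (1, 0) w := by
  rw [LorentzianMetric.flat, g.metricRep_apply, hφ.chartSymmDeriv_eq hx,
    hφ.isSmoothChart.coordField_symm hx]

theorem metricRep_neg (hφ : IsAdaptedChart φ ξ ε) (h : g.IsTHOCKV ξ κ φ.source)
    {x : ℝ × Space n} (hx : x ∈ φ.target) : g.metricRep φ x (1, 0) (1, 0) < 0 := by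
  rw [g.metricRep_apply, hφ.chartSymmDeriv_eq hx]
  exact h.timelike _ (φ.map_target hx)

theorem smoothFieldAt (h : g.IsTHOCKV ξ κ φ.source) {x : ℝ × Space n} (hx : x ∈ φ.target) :
    SmoothFieldAt ξ (φ.symm x) :=
  h.conformalKilling.1.contMDiffAt (φ.open_source.mem_nhds (φ.map_target hx))

theorem hasFDerivAt_metricRep (hφ : IsAdaptedChart φ ξ ε) {x : ℝ × Space n} (hx : x ∈ φ.target)
    (v w : ℝ × Space n) : HasFDerivAt (fun y ↦ g.metricRep φ y v w)
      (fderiv ℝ (fun y ↦ g.metricRep φ y v w) x) x :=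
  (((((hφ.isSmoothChart.contDiffOn_metricRep g).contDiffAt
    (φ.open_target.mem_nhds hx)).clm_apply contDiffAt_const).clm_apply
      contDiffAt_const).differentiableAt (by simp)).hasFDerivAt

/-- Along the first coordinate the components of the metric satisfy a linear equation. -/
theorem hasDerivAt_metricRep (hφ : IsAdaptedChart φ ξ ε) (h : g.IsTHOCKV ξ κ φ.source) {s : ℝ}
    {q : Space n} (hx : (s, q) ∈ φ.target) (v w : ℝ × Space n) :
    HasDerivAt (fun s ↦ g.metricRep φ (s, q) v w)
      (2 * κ (φ.symm (s, q)) * g.metricRep φ (s, q) v w) s := by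
  have hc := hφ.isSmoothChart
  have hp := φ.map_target hx
  have hcurve : HasDerivAt (fun s : ℝ ↦ (s, q)) ((1 : ℝ), (0 : Space n)) s :=
    (hasDerivAt_id s).prodMk (hasDerivAt_const s q)
  have h1 := HasFDerivAt.comp_hasDerivAt (f := fun s : ℝ ↦ (s, q)) s
    (hφ.hasFDerivAt_metricRep (g := g) hx v w) hcurve
  refine h1.congr_deriv ?_
  have hX := hc.smoothFieldAt_coordField hp v
  have hY := hc.smoothFieldAt_coordField hp w
  have hξ := smoothFieldAt h hx
  have h2 := h.conformalKilling.2.2 _ hp _ _ hX hY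
  -- Fields with constant components commute, so the Lie derivative of the metric along `ξ` reduces
  -- to the derivative of its components in `s`.
  have hb : ∀ u, bracket ξ (coordField φ u) (φ.symm (s, q)) = 0 := fun u ↦
    hc.bracket_eq_zero hx hξ (hc.smoothFieldAt_coordField hp u) hφ.chartDeriv_eq
      (fun p hp ↦ hc.chartDeriv_coordField hp u)
  rw [g.nabla_add_swap, hb, hb, map_zero, map_zero, zero_apply, sub_zero, sub_zero,
    hc.diff_eq hx, hφ.chartDeriv_eq _ hp, hc.coordField_symm hx, hc.coordField_symm hx,
    ← g.metricRep_apply] at h2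
  rw [← h2]
  have h3 : g.inn (coordField φ v) (coordField φ w) ∘ φ.symm =ᶠ[𝓝 (s, q)]
      fun y ↦ g.metricRep φ y v w := by
    filter_upwards [φ.open_target.mem_nhds hx] with y hy using hc.inn_coordField g hy v w
  rw [h3.fderiv_eq]

/-- On a line of fixed `q` all components solve `y' = 2κ y`, so each is a constant multiple of the
nowhere vanishing `g(ξ, ξ)`. The metric on the line is thus conformal to its value at `s = 0`. -/
theorem metricRep_ratio (hφ : IsAdaptedChart φ ξ ε) (h : g.IsTHOCKV ξ κ φ.source) {s : ℝ}
    {q : Space n} (hs : s ∈ Metric.ball (0 : ℝ) ε) (hq : q ∈ Metric.ball (0 : Space n) ε)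
    (v w : ℝ × Space n) :
    g.metricRep φ (s, q) v w * g.metricRep φ (0, q) (1, 0) (1, 0)
      = g.metricRep φ (0, q) v w * g.metricRep φ (s, q) (1, 0) (1, 0) :=
  mul_eq_mul_of_hasDerivAt hφ.pos (fun _ hr ↦ hφ.hasDerivAt_metricRep h (hφ.mem_target hr hq) v w)
    (fun _ hr ↦ hφ.hasDerivAt_metricRep h (hφ.mem_target hr hq) _ _)
    (fun _ hr ↦ (hφ.metricRep_neg h (hφ.mem_target hr hq)).ne) hs

end IsAdaptedChart

/-- Coordinates `(s, q)` on a product of balls in which a given conformal Killing vector is `∂_s`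
and orthogonal to the slices of constant `s`. -/
structure IsConformalChart (g : LorentzianMetric n M) (φ : OpenPartialHomeomorph M (ℝ × Space n))
    (ξ : VField n M) (κ : M → ℝ) (ε : ℝ) : Prop extends IsAdaptedChart φ ξ ε where
  isTHOCKV : g.IsTHOCKV ξ κ φ.source
  orthogonal : ∀ x ∈ φ.target, ∀ w : Space n, g.metricRep φ x (1, 0) (0, w) = 0

/-- The slice `s = 0` is a level set of `k`, and `ξ♭ = f dk` vanishes on its tangent vectors.
Proportionality along the flow carries this orthogonality to every slice. -/
theorem exists_isConformalChart (h : g.IsTHOCKV ξ κ U) {p : M} (hp : p ∈ U) :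
    ∃ (φ : OpenPartialHomeomorph M (ℝ × Space n)) (ε : ℝ), IsConformalChart g φ ξ κ ε ∧
      p ∈ φ.source ∧ φ.source ⊆ U := by
  obtain ⟨V, hV, hpV, hVU, f, k, hf, hk, hfk⟩ := h.hypersurfaceOrthogonal p hp
  -- Transversality follows from timelikeness: `f dk(ξ) = g(ξ, ξ) < 0`.
  have htr : diff n k p (ξ p) ≠ 0 := fun h0 ↦ by
    have h1 : g.flat ξ p (ξ p) = f p * diff n k p (ξ p) := by
      rw [(hfk p hpV).2]
      rfl
    rw [h0, mul_zero] at h1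
    exact (h.timelike p hp).ne h1
  obtain ⟨φ, ε, hφ, hpφ, hφV, hlev⟩ :=
    exists_isAdaptedChart hV hpV (h.conformalKilling.1.mono hVU) hk htr
  have hφ' : g.IsTHOCKV ξ κ φ.source := h.mono φ.open_source (hφV.trans hVU)
  have h0 : (0 : ℝ) ∈ Metric.ball (0 : ℝ) ε := Metric.mem_ball_self hφ.pos
  have hzero : ∀ q ∈ Metric.ball (0 : Space n) ε, ∀ w : Space n,
      g.metricRep φ (0, q) (1, 0) (0, w) = 0 := by
    intro q hq w
    have hx := hφ.mem_target h0 hq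
    have hc := hφ.isSmoothChart
    have hV' := hφV (φ.map_target hx)
    rw [← hφ.flat_coordField hx, (hfk _ hV').2]
    change f _ * diff n k _ _ = 0
    rw [hc.diff_eq hx, hc.chartDeriv_coordField (φ.map_target hx)]
    have h1 : HasFDerivAt (k ∘ φ.symm) (fderiv ℝ (k ∘ φ.symm) (0, q)) (0, q) :=
      ((hc.contDiffAt_comp_symm hx
        (hk.contMDiffAt (hV.mem_nhds hV'))).differentiableAt (by simp)).hasFDerivAt
    have h2 : HasFDerivAt (fun q : Space n ↦ ((0 : ℝ), q)) (ContinuousLinearMap.inr ℝ ℝ (Space n))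
        q := (ContinuousLinearMap.inr ℝ ℝ (Space n)).hasFDerivAt
    have h3 := HasFDerivAt.comp (f := fun q : Space n ↦ ((0 : ℝ), q)) q h1 h2
    have h4 : ((k ∘ φ.symm) ∘ fun q : Space n ↦ ((0 : ℝ), q)) =ᶠ[𝓝 q] fun _ ↦ k p := by
      filter_upwards [Metric.isOpen_ball.mem_nhds hq] with r hr using hlev r hr
    have h5 := h3.unique ((hasFDerivAt_const (k p) q).congr_of_eventuallyEq h4)
    have h6 : fderiv ℝ (k ∘ φ.symm) (0, q) (0, w) = 0 := DFunLike.congr_fun h5 w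
    rw [h6, mul_zero]
  refine ⟨φ, ε, ⟨hφ, hφ', fun x hx w ↦ ?_⟩, hpφ, hφV.trans hVU⟩
  have hx' := hx
  rw [hφ.target_eq] at hx'
  have h7 := hφ.metricRep_ratio hφ' hx'.1 hx'.2 (1, 0) (0, w)
  rw [hzero _ hx'.2, zero_mul] at h7
  exact (mul_eq_zero.1 h7).resolve_right (hφ.metricRep_neg hφ' (hφ.mem_target h0 hx'.2)).ne

namespace IsConformalChart

theorem hasFDerivAt_slice (hφ : IsConformalChart g φ ξ κ ε) {s : ℝ} {q : Space n}
    (hx : (s, q) ∈ φ.target) (v w : ℝ × Space n) :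
    HasFDerivAt (fun q ↦ g.metricRep φ (s, q) v w)
      ((fderiv ℝ (fun y ↦ g.metricRep φ y v w) (s, q)).comp
        (ContinuousLinearMap.inr ℝ ℝ (Space n))) q :=
  HasFDerivAt.comp (f := fun q : Space n ↦ (s, q)) q
    (hφ.toIsAdaptedChart.hasFDerivAt_metricRep hx v w) (hasFDerivAt_prodMk_right s q)

/-- The exterior derivative of `ξ_i` on `∂_s` and a spatial coordinate field. -/
theorem extDer_flat (hφ : IsConformalChart g φ ξ κ ε) {x : ℝ × Space n} (hx : x ∈ φ.target)
    (w : Space n) :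
    extDer (g.flat ξ) (coordField φ (1, 0)) (coordField φ (0, w)) (φ.symm x)
      = -fderiv ℝ (fun y ↦ g.metricRep φ y (1, 0) (1, 0)) x (0, w) := by
  have hc := hφ.isSmoothChart
  have hp := φ.map_target hx
  have hb : bracket (coordField φ (1, 0)) (coordField φ (0, w)) (φ.symm x) = 0 :=
    hc.bracket_eq_zero hx (hc.smoothFieldAt_coordField hp _) (hc.smoothFieldAt_coordField hp _)
      (fun p hp ↦ hc.chartDeriv_coordField hp _) (fun p hp ↦ hc.chartDeriv_coordField hp _)
  have h1 : ∀ v, (fun q ↦ g.flat ξ q (coordField φ v q)) ∘ φ.symm =ᶠ[𝓝 x]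
      fun y ↦ g.metricRep φ y (1, 0) v := fun v ↦ by
    filter_upwards [φ.open_target.mem_nhds hx] with y hy
      using hφ.toIsAdaptedChart.flat_coordField hy v
  have h2 : (fun q ↦ g.flat ξ q (coordField φ (0, w) q)) ∘ φ.symm =ᶠ[𝓝 x] fun _ ↦ 0 := by
    filter_upwards [φ.open_target.mem_nhds hx] with y hy
    rw [Function.comp_apply, hφ.toIsAdaptedChart.flat_coordField hy, hφ.orthogonal y hy]
  rw [extDer, hb, map_zero, hc.diff_eq hx, hc.diff_eq hx, hc.chartDeriv_coordField hp,
    hc.chartDeriv_coordField hp, (h1 (1, 0)).fderiv_eq, h2.fderiv_eq, fderiv_const_apply]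
  simp

/-- If `ξ_i` is closed, its length depends only on the first coordinate. -/
theorem metricRep_of_closed (hφ : IsConformalChart g φ ξ κ ε)
    (hcl : ClosedOn (g.flat ξ) φ.source) {s : ℝ} {q : Space n} (hs : s ∈ Metric.ball (0 : ℝ) ε)
    (hq : q ∈ Metric.ball (0 : Space n) ε) :
    g.metricRep φ (s, q) (1, 0) (1, 0) = g.metricRep φ (s, 0) (1, 0) (1, 0) := by
  have hc := hφ.isSmoothChart
  refine eq_of_fderiv_eq_zero_on_ball hφ.pos
    (fun r hr ↦ hφ.hasFDerivAt_slice (hφ.mem_target hs hr) (1, 0) (1, 0)) (fun r hr w ↦ ?_) hq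
  have hx := hφ.mem_target hs hr
  have hp := φ.map_target hx
  have h1 := hcl _ hp _ _ (hc.smoothFieldAt_coordField hp (1, 0))
    (hc.smoothFieldAt_coordField hp (0, w))
  rw [hφ.extDer_flat hx, neg_eq_zero] at h1
  exact h1

/-- If the gradient of the conformal function is parallel to `ξ`, the length of `ξ` is a product
of a function of the first coordinate and one of the others. -/
theorem metricRep_of_parallel (hφ : IsConformalChart g φ ξ κ ε)
    (hpar : ∀ p ∈ φ.source, ∃ c : ℝ, diff n κ p = c • g.flat ξ p) {s : ℝ} {q : Space n}
    (hs : s ∈ Metric.ball (0 : ℝ) ε) (hq : q ∈ Metric.ball (0 : Space n) ε) :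
    g.metricRep φ (s, q) (1, 0) (1, 0) * g.metricRep φ (0, 0) (1, 0) (1, 0)
      = g.metricRep φ (0, q) (1, 0) (1, 0) * g.metricRep φ (s, 0) (1, 0) (1, 0) := by
  have hc := hφ.isSmoothChart
  have h0 : (0 : Space n) ∈ Metric.ball (0 : Space n) ε := Metric.mem_ball_self hφ.pos
  -- `dκ` is a multiple of `ξ♭`, which vanishes on spatial vectors, so `κ` is constant on each
  -- slice. The lengths of `ξ` over `q` and over `0` then solve the same equation in `s`.
  have hκ : ∀ r ∈ Metric.ball (0 : ℝ) ε, κ (φ.symm (r, q)) = κ (φ.symm (r, 0)) := by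
    intro r hr
    have hd : ∀ y ∈ Metric.ball (0 : Space n) ε, HasFDerivAt (fun y ↦ (κ ∘ φ.symm) (r, y))
        ((fderiv ℝ (κ ∘ φ.symm) (r, y)).comp (ContinuousLinearMap.inr ℝ ℝ (Space n))) y := by
      intro y hy
      have hx := hφ.mem_target hr hy
      have h1 : HasFDerivAt (κ ∘ φ.symm) (fderiv ℝ (κ ∘ φ.symm) (r, y)) (r, y) :=
        ((hc.contDiffAt_comp_symm hx (hφ.isTHOCKV.conformalKilling.2.1.contMDiffAt
          (φ.open_source.mem_nhds (φ.map_target hx)))).differentiableAt (by simp)).hasFDerivAt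
      exact HasFDerivAt.comp (f := fun q : Space n ↦ (r, q)) y h1 (hasFDerivAt_prodMk_right r y)
    refine eq_of_fderiv_eq_zero_on_ball hφ.pos hd (fun y hy w ↦ ?_) hq
    have hx := hφ.mem_target hr hy
    have hp := φ.map_target hx
    obtain ⟨c, hcc⟩ := hpar _ hp
    have h2 := hc.diff_eq hx κ (coordField φ (0, w) (φ.symm (r, y)))
    rw [hc.chartDeriv_coordField hp, hcc] at h2
    change fderiv ℝ (κ ∘ φ.symm) (r, y) (0, w) = 0
    rw [← h2]
    change c * g.flat ξ _ _ = 0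
    rw [hφ.toIsAdaptedChart.flat_coordField hx, hφ.orthogonal _ hx, mul_zero]
  have h3 := mul_eq_mul_of_hasDerivAt hφ.pos
    (u := fun r ↦ g.metricRep φ (r, q) (1, 0) (1, 0))
    (v := fun r ↦ g.metricRep φ (r, 0) (1, 0) (1, 0))
    (k := fun r ↦ 2 * κ (φ.symm (r, 0)))
    (fun r hr ↦ by
      have := hφ.hasDerivAt_metricRep hφ.isTHOCKV (hφ.mem_target hr hq) (1, 0) (1, 0)
      rwa [hκ r hr] at this)
    (fun r hr ↦ hφ.hasDerivAt_metricRep hφ.isTHOCKV (hφ.mem_target hr h0) (1, 0) (1, 0))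
    (fun r hr ↦ (hφ.metricRep_neg hφ.isTHOCKV (hφ.mem_target hr h0)).ne) hs
  exact h3

/-- If the associated 1-form is closed, the length of `ξ` is a product of a function of the first
coordinate and one of the others. -/
theorem metricRep_of_associatedForm_closed (hφ : IsConformalChart g φ ξ κ ε) {α : OneForm n M}
    (hα : g.AssociatedFormOn ξ κ α φ.source) (hcl : ClosedOn α φ.source) {s : ℝ} {q : Space n}
    (hs : s ∈ Metric.ball (0 : ℝ) ε) (hq : q ∈ Metric.ball (0 : Space n) ε) :
    g.metricRep φ (s, q) (1, 0) (1, 0) * g.metricRep φ (0, 0) (1, 0) (1, 0)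
      = g.metricRep φ (0, q) (1, 0) (1, 0) * g.metricRep φ (s, 0) (1, 0) (1, 0) := by
  have hc := hφ.isSmoothChart
  obtain ⟨hαs, hαξ, hασ⟩ := hα
  set N : ℝ × Space n → ℝ := fun x ↦ g.metricRep φ x (1, 0) (1, 0) with hN
  set A : Space n → ℝ × Space n → ℝ := fun w ↦ (fun p ↦ α p (coordField φ (0, w) p)) ∘ φ.symm
    with hA
  have h0 : (0 : ℝ) ∈ Metric.ball (0 : ℝ) ε := Metric.mem_ball_self hφ.pos
  have hne : ∀ x ∈ φ.target, N x ≠ 0 := fun x hx ↦ (hφ.metricRep_neg hφ.isTHOCKV hx).ne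
  -- This is `dξ♭ = 2 α ∧ ξ♭` evaluated on `∂_s` and `∂_w`, using `α(∂_s) = 0` and orthogonality.
  have hder : ∀ x ∈ φ.target, ∀ w : Space n, fderiv ℝ N x (0, w) = 2 * N x * A w x := by
    intro x hx w
    have hp := φ.map_target hx
    have h1 := g.nabla_sub_swap ξ (coordField φ (1, 0)) (coordField φ (0, w)) (φ.symm x)
    have hX := hc.smoothFieldAt_coordField hp (1, 0)
    have hY := hc.smoothFieldAt_coordField hp (0, w)
    rw [hφ.extDer_flat hx, hασ _ hp _ _ hX hY, hασ _ hp _ _ hY hX,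
      hφ.toIsAdaptedChart.flat_coordField hx, hφ.toIsAdaptedChart.flat_coordField hx,
      hφ.orthogonal x hx, hφ.toIsAdaptedChart.coordField_eq hp, hαξ _ hp,
      g.symm _ (ξ (φ.symm x))] at h1
    change _ = 2 * N x * α (φ.symm x) (coordField φ (0, w) (φ.symm x))
    linarith
  -- Since `α(∂_s) = 0`, the equation `dα(∂_s, ∂_w) = 0` reads `∂_s (α(∂_w)) = 0`.
  have hconst : ∀ w : Space n, ∀ y ∈ Metric.ball (0 : Space n) ε, A w (s, y) = A w (0, y) := by
    intro w y hy
    have hd : ∀ r ∈ Metric.ball (0 : ℝ) ε, HasDerivAt (fun r ↦ A w (r, y))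
        (fderiv ℝ (A w) (r, y) (1, 0)) r := by
      intro r hr
      have hx := hφ.mem_target hr hy
      have hp := φ.map_target hx
      have h1 : HasFDerivAt (A w) (fderiv ℝ (A w) (r, y)) (r, y) :=
        ((hc.contDiffAt_comp_symm hx (contMDiffAt_form_apply φ.open_source hp hαs
          (hc.smoothFieldAt_coordField hp (0, w)))).differentiableAt (by simp)).hasFDerivAt
      exact HasFDerivAt.comp_hasDerivAt (f := fun r : ℝ ↦ (r, y)) r h1
        ((hasDerivAt_id r).prodMk (hasDerivAt_const r y))
    refine eq_of_deriv_eq_zero_on_ball hφ.pos hd (fun r hr ↦ ?_) hs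
    have hx := hφ.mem_target hr hy
    have hp := φ.map_target hx
    have hX := hc.smoothFieldAt_coordField hp (1, 0)
    have hY := hc.smoothFieldAt_coordField hp (0, w)
    have h2 := hcl _ hp _ _ hX hY
    have hb : bracket (coordField φ (1, 0)) (coordField φ (0, w)) (φ.symm (r, y)) = 0 :=
      hc.bracket_eq_zero hx hX hY (fun p hp ↦ hc.chartDeriv_coordField hp _)
        (fun p hp ↦ hc.chartDeriv_coordField hp _)
    have h3 : (fun p ↦ α p (coordField φ (1, 0) p)) ∘ φ.symm =ᶠ[𝓝 (r, y)] fun _ ↦ 0 := by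
      filter_upwards [φ.open_target.mem_nhds hx] with z hz
      have hz' := φ.map_target hz
      rw [Function.comp_apply, hφ.toIsAdaptedChart.coordField_eq hz', hαξ _ hz']
    rw [extDer, hb, map_zero, hc.diff_eq hx, hc.diff_eq hx, hc.chartDeriv_coordField hp,
      h3.fderiv_eq, fderiv_const_apply, sub_zero, zero_apply, sub_zero] at h2
    exact h2
  -- The logarithmic derivatives of `N(s, ·)` and `N(0, ·)` are both `2 α(∂_w)`, so their quotient
  -- is constant.
  have h4 : N (s, q) / N (0, q) = N (s, 0) / N (0, 0) := by
    simp only [div_eq_mul_inv]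
    refine eq_of_fderiv_eq_zero_on_ball hφ.pos (f := fun y ↦ N (s, y) * (N (0, y))⁻¹)
      (fun y hy ↦ HasFDerivAt.fun_mul (hφ.hasFDerivAt_slice (hφ.mem_target hs hy) (1, 0) (1, 0))
        ((hasDerivAt_inv (hne _ (hφ.mem_target h0 hy))).comp_hasFDerivAt y
          (hφ.hasFDerivAt_slice (hφ.mem_target h0 hy) (1, 0) (1, 0)))) (fun y hy w ↦ ?_) hq
    have e1 := hder _ (hφ.mem_target hs hy) w
    have e2 := hder _ (hφ.mem_target h0 hy) w
    rw [hconst w y hy] at e1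
    change N (s, y) * (-(N (0, y) ^ 2)⁻¹ * fderiv ℝ N (0, y) (0, w))
      + (N (0, y))⁻¹ * fderiv ℝ N (s, y) (0, w) = 0
    rw [e1, e2]
    have := hne _ (hφ.mem_target h0 hy)
    field_simp
    ring
  have h00 : (0 : Space n) ∈ Metric.ball (0 : Space n) ε := Metric.mem_ball_self hφ.pos
  rw [div_eq_div_iff (hne _ (hφ.mem_target h0 hq)) (hne _ (hφ.mem_target h0 h00))] at h4
  rw [hN] at h4
  simp only at h4
  rw [h4, mul_comm]

end IsConformalChart

end ConformalCharts

/-! ### The new time coordinate and the doubly warped form -/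

/-- A smooth positive function on an interval is the derivative of a local diffeomorphism. -/
theorem exists_primitive_openPartialHomeomorph {ε : ℝ} {A : ℝ → ℝ}
    (hA : ContDiffOn ℝ ∞ A (Metric.ball 0 ε)) (hpos : ∀ s ∈ Metric.ball (0 : ℝ) ε, 0 < A s)
    {s₀ : ℝ} (hs₀ : s₀ ∈ Metric.ball (0 : ℝ) ε) :
    ∃ Φ : OpenPartialHomeomorph ℝ ℝ, s₀ ∈ Φ.source ∧ Φ.source ⊆ Metric.ball 0 ε ∧
      ContDiffOn ℝ ∞ Φ Φ.source ∧ ContDiffOn ℝ ∞ Φ.symm Φ.target ∧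
      ∀ s ∈ Φ.source, HasDerivAt Φ (A s) s := by
  have h0 : (0 : ℝ) ∈ Metric.ball (0 : ℝ) ε :=
    Metric.mem_ball_self ((dist_nonneg).trans_lt (Metric.mem_ball.1 hs₀))
  set T : ℝ → ℝ := fun s ↦ ∫ x in (0 : ℝ)..s, A x
  have hT : ∀ s ∈ Metric.ball (0 : ℝ) ε, HasDerivAt T (A s) s := by
    intro s hs
    refine intervalIntegral.integral_hasDerivAt_right
      (ContinuousOn.intervalIntegrable (hA.continuousOn.mono ?_))
      (hA.continuousOn.stronglyMeasurableAtFilter Metric.isOpen_ball s hs)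
      (hA.continuousOn.continuousAt (Metric.isOpen_ball.mem_nhds hs))
    exact ((convex_ball (0 : ℝ) ε).ordConnected).uIcc_subset h0 hs
  have hTs : ContDiffOn ℝ ∞ T (Metric.ball 0 ε) :=
    (contDiffOn_infty_iff_deriv_of_isOpen Metric.isOpen_ball).2
      ⟨fun s hs ↦ (hT s hs).differentiableAt.differentiableWithinAt,
        hA.congr fun s hs ↦ (hT s hs).deriv⟩
  obtain ⟨Φ, hmem, hsub, hΦ, hsymm⟩ := exists_smooth_openPartialHomeomorph Metric.isOpen_ball hTs
    hs₀ _ ((hT s₀ hs₀).hasFDerivAt_equiv (hpos s₀ hs₀).ne')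
  have hΦT : ⇑Φ = T := funext hΦ
  exact ⟨Φ, hmem, hsub, by rw [hΦT]; exact hTs.mono hsub, hsymm,
    fun s hs ↦ by rw [hΦT]; exact hT s (hsub hs)⟩

section ConformalCharts

variable {n : ℕ} {M : Type*} [TopologicalSpace M] [ChartedSpace (Model n) M]
  [IsManifold (𝓡 (n + 1)) ∞ M] {g : LorentzianMetric n M} {ξ : VField n M} {κ : M → ℝ}
  {φ : OpenPartialHomeomorph M (ℝ × Space n)} {ε : ℝ}

namespace IsConformalChart

/-- The metric on the slice `s = 0`. -/
def sliceMetric (g : LorentzianMetric n M) (φ : OpenPartialHomeomorph M (ℝ × Space n))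
    (q : Space n) : Space n →L[ℝ] Space n →L[ℝ] ℝ :=
  (g.metricRep φ (0, q)).bilinearComp (ContinuousLinearMap.inr ℝ ℝ (Space n))
    (ContinuousLinearMap.inr ℝ ℝ (Space n))

theorem sliceMetric_apply (q v w : Space n) :
    sliceMetric g φ q v w = g.metricRep φ (0, q) (0, v) (0, w) := rfl

theorem contDiffOn_sliceMetric (hφ : IsConformalChart g φ ξ κ ε) :
    ContDiffOn ℝ ∞ (sliceMetric g φ) (Metric.ball 0 ε) := by
  have h0 : (0 : ℝ) ∈ Metric.ball (0 : ℝ) ε := Metric.mem_ball_self hφ.pos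
  have h : ContDiffOn ℝ ∞ (fun q : Space n ↦ g.metricRep φ (0, q)) (Metric.ball 0 ε) :=
    (hφ.isSmoothChart.contDiffOn_metricRep g).comp
      (contDiff_prodMk_right (0 : ℝ)).contDiffOn fun q hq ↦ hφ.mem_target h0 hq
  exact contDiffOn_clm_apply.2 fun v ↦ contDiffOn_clm_apply.2 fun w ↦
    (h.clm_apply contDiffOn_const).clm_apply contDiffOn_const

/-- Spatial vectors are orthogonal to the timelike `ξ`, hence spacelike. -/
theorem metricRep_space_pos (hφ : IsConformalChart g φ ξ κ ε) {x : ℝ × Space n}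
    (hx : x ∈ φ.target) {w : Space n} (hw : w ≠ 0) : 0 < g.metricRep φ x (0, w) (0, w) := by
  have hc := hφ.isSmoothChart
  refine g.pos_of_orthogonal_timelike (hφ.metricRep_neg hφ.isTHOCKV hx) (hφ.orthogonal x hx w) ?_
  intro h
  have h1 := hc.chartDeriv_symm hx (0, w)
  have h2 : chartDeriv φ (φ.symm x) (chartSymmDeriv φ x (0, w)) = 0 :=
    (congrArg _ h).trans (map_zero _)
  exact hw (congrArg Prod.snd (h1.symm.trans h2))

theorem metricRep_apply_eq (hφ : IsConformalChart g φ ξ κ ε) {x : ℝ × Space n}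
    (hx : x ∈ φ.target) (v w : ℝ × Space n) :
    g.metricRep φ x v w = v.1 * w.1 * g.metricRep φ x (1, 0) (1, 0)
      + g.metricRep φ x (0, v.2) (0, w.2) := by
  have hd : ∀ v : ℝ × Space n, v = v.1 • ((1 : ℝ), (0 : Space n)) + (0, v.2) := fun v ↦ by
    ext <;> simp
  conv_lhs => rw [hd v, hd w]
  simp only [map_add, map_smul, add_apply, smul_apply, smul_eq_mul,
    hφ.orthogonal x hx, g.metricRep_comm x (0, v.2) (1, 0)]
  ring

/-- If the length of `ξ` is a product of a function of the first coordinate and one of the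
others, then after a change of the first coordinate the metric is doubly warped. -/
theorem exists_isDoublyWarpedChart (hφ : IsConformalChart g φ ξ κ ε) {p : M} (hp : p ∈ φ.source)
    {A : ℝ → ℝ} {B : Space n → ℝ} (hA : ContDiffOn ℝ ∞ A (Metric.ball 0 ε))
    (hA0 : ∀ s ∈ Metric.ball (0 : ℝ) ε, 0 < A s) (hB : ContDiffOn ℝ ∞ B (Metric.ball 0 ε))
    (hB0 : ∀ q ∈ Metric.ball (0 : Space n) ε, 0 < B q)
    (hAB : ∀ s ∈ Metric.ball (0 : ℝ) ε, ∀ q ∈ Metric.ball (0 : Space n) ε,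
      g.metricRep φ (s, q) (1, 0) (1, 0) = -((A s) ^ 2 * (B q) ^ 2)) :
    ∃ (φ' : OpenPartialHomeomorph M (ℝ × Space n)) (a : ℝ → ℝ)
      (gs : Space n → (Space n →L[ℝ] Space n →L[ℝ] ℝ)), p ∈ φ'.source ∧ φ'.source ⊆ φ.source ∧
        g.IsDoublyWarpedChart φ' a B gs := by
  have hc := hφ.isSmoothChart
  have hball : ∀ x ∈ φ.target, x.1 ∈ Metric.ball (0 : ℝ) ε ∧ x.2 ∈ Metric.ball (0 : Space n) ε :=
    fun x hx ↦ by rwa [hφ.target_eq] at hx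
  have h0 : (0 : ℝ) ∈ Metric.ball (0 : ℝ) ε := Metric.mem_ball_self hφ.pos
  have hA00 := hA0 0 h0
  -- The new time is `t = Φ(s)` with `dt = A ds`, which absorbs the factor `A²` of `ds²`.
  obtain ⟨Φ, hmem, hsub, hΦ, hΦs, hder⟩ :=
    exists_primitive_openPartialHomeomorph hA hA0 (hball _ (φ.map_source hp)).1
  set Ψ := Φ.prod (OpenPartialHomeomorph.refl (Space n)) with hΨdef
  have hΨ : ContDiffOn ℝ ∞ Ψ Ψ.source :=
    (hΦ.comp contDiff_fst.contDiffOn fun x hx ↦ hx.1).prodMk contDiff_snd.contDiffOn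
  have hΨs : ContDiffOn ℝ ∞ Ψ.symm Ψ.target :=
    (hΦs.comp contDiff_fst.contDiffOn fun x hx ↦ hx.1).prodMk contDiff_snd.contDiffOn
  have hsrc : ∀ x ∈ (φ.trans Ψ).source, x ∈ φ.source ∧ (φ x).1 ∈ Φ.source := fun x hx ↦ by
    rw [OpenPartialHomeomorph.trans_source] at hx
    exact ⟨hx.1, hx.2.1⟩
  have htgt : ∀ y ∈ (φ.trans Ψ).target, y.1 ∈ Φ.target ∧ y.2 ∈ Metric.ball (0 : Space n) ε :=
    fun y hy ↦ by
      rw [OpenPartialHomeomorph.trans_target] at hy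
      exact ⟨hy.1.1, (hball _ hy.2).2⟩
  have hT := hc.trans hΨ hΨs
  have hdΨ : ∀ x ∈ (φ.trans Ψ).source, ∀ v : ℝ × Space n,
      fderiv ℝ Ψ (φ x) v = (A (φ x).1 * v.1, v.2) := by
    intro x hx v
    have h1 : HasFDerivAt (fun y : ℝ × Space n ↦ (Φ y.1, y.2)) _ (φ x) :=
      ((hder _ (hsrc x hx).2).comp_hasFDerivAt (φ x)
        (hasFDerivAt_fst (𝕜 := ℝ) (E := ℝ) (F := Space n) (p := φ x))).prodMk
          (hasFDerivAt_snd (𝕜 := ℝ) (E := ℝ) (F := Space n) (p := φ x))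
    have h2 : fderiv ℝ Ψ (φ x) = _ := h1.fderiv
    rw [h2]
    rfl
  have hAΦ : ∀ t ∈ Φ.target, Φ.symm t ∈ Metric.ball (0 : ℝ) ε := fun t ht ↦ hsub (Φ.map_target ht)
  -- The spatial metric at `s` is `(A(s) / A(0))²` times the slice metric; the factor `A(0)⁻²` goes
  -- into the fixed metric and leaves `a(t) = A(s(t))`.
  refine ⟨φ.trans Ψ, fun t ↦ A (Φ.symm t), fun q ↦ ((A 0) ^ 2)⁻¹ • sliceMetric g φ q, ?_,
    fun x hx ↦ (hsrc x hx).1, hT.smooth, hT.smooth_symm, ?_, ?_, ?_, ?_, ?_, ?_, ?_, ?_⟩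
  · rw [OpenPartialHomeomorph.trans_source]
    exact ⟨hp, hmem, mem_univ _⟩
  · rintro _ ⟨y, hy, rfl⟩
    exact (((hA.comp hΦs hAΦ).contDiffAt (Φ.open_target.mem_nhds (htgt y hy).1))).contDiffWithinAt
  · refine hB.mono ?_
    rintro _ ⟨y, hy, rfl⟩
    exact (htgt y hy).2
  · refine ContDiffOn.mono (contDiffOn_clm_apply.2 fun v ↦ contDiffOn_clm_apply.2 fun w ↦
      contDiffOn_const.mul ((hφ.contDiffOn_sliceMetric.clm_apply
        (contDiffOn_const (c := v))).clm_apply (contDiffOn_const (c := w)))) ?_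
    rintro _ ⟨y, hy, rfl⟩
    exact (htgt y hy).2
  · rintro _ ⟨y, hy, rfl⟩
    exact hA0 _ (hAΦ _ (htgt y hy).1)
  · rintro _ ⟨y, hy, rfl⟩
    exact hB0 _ (htgt y hy).2
  · intro q _ v w
    simp only [smul_apply, sliceMetric_apply, g.metricRep_comm (0, q) (0, v)]
  · rintro _ ⟨y, hy, rfl⟩ v hv
    exact mul_pos (by positivity)
      (hφ.metricRep_space_pos (hφ.mem_target h0 (htgt y hy).2) hv)
  · intro x hx v w
    obtain ⟨hx1, hx2⟩ := hsrc x hx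
    have hy := φ.map_source hx1
    obtain ⟨hs, hq⟩ := hball _ hy
    have hdv : ∀ v, (mfderiv (𝓡 (n + 1)) 𝓘(ℝ, ℝ × Space n) (φ.trans Ψ) x v : ℝ × Space n)
        = (A (φ x).1 * (chartDeriv φ x v).1, (chartDeriv φ x v).2) := fun v ↦
      (hc.chartDeriv_trans hΨ hx v).trans (hdΨ x hx _)
    simp only [hdv]
    rw [hc.val_eq_metricRep g hx1, hφ.metricRep_apply_eq hy]
    set v' := chartDeriv φ x v
    set w' := chartDeriv φ x w
    have hr := hφ.metricRep_ratio hφ.isTHOCKV hs hq (0, v'.2) (0, w'.2)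
    have e1 : ((φ.trans Ψ) x).1 = Φ (φ x).1 := rfl
    have e2 : ((φ.trans Ψ) x).2 = (φ x).2 := rfl
    rw [hAB 0 h0 _ hq, hAB _ hs _ hq] at hr
    rw [e1, e2, Φ.left_inv hx2, smul_apply, smul_apply, sliceMetric_apply, smul_eq_mul]
    have hBq := hB0 _ hq
    -- In the proportionality along the flow the factor `B²` occurs on both sides and cancels.
    have hr' : g.metricRep φ (φ x) (0, v'.2) (0, w'.2)
        = (A (φ x).1) ^ 2 * ((A 0 ^ 2)⁻¹ * g.metricRep φ (0, (φ x).2) (0, v'.2) (0, w'.2)) := by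
      field_simp
      refine mul_right_cancel₀ (pow_pos hBq 2).ne' ?_
      change g.metricRep φ (φ x) (0, v'.2) (0, w'.2) * _ = _ at hr
      linarith
    rw [hr']
    have hAB' : g.metricRep φ (φ x) (1, 0) (1, 0)
        = -((A (φ x).1) ^ 2 * (B (φ x).2) ^ 2) := hAB _ hs _ hq
    rw [hAB']
    ring

/-- The function `√(-g(ξ, ξ))` is smooth on the axis `q = 0`. -/
theorem contDiffOn_sqrt_axis (hφ : IsConformalChart g φ ξ κ ε) :
    ContDiffOn ℝ ∞ (fun s ↦ √(-g.metricRep φ (s, (0 : Space n)) (1, 0) (1, 0)))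
      (Metric.ball 0 ε) := by
  have h0 : (0 : Space n) ∈ Metric.ball (0 : Space n) ε := Metric.mem_ball_self hφ.pos
  have h : ContDiffOn ℝ ∞ (fun s : ℝ ↦ g.metricRep φ (s, (0 : Space n))) (Metric.ball 0 ε) :=
    (hφ.isSmoothChart.contDiffOn_metricRep g).comp
      (contDiff_prodMk_left (0 : Space n)).contDiffOn fun s hs ↦ hφ.mem_target hs h0
  exact ((h.clm_apply contDiffOn_const).clm_apply contDiffOn_const).neg.sqrt fun s hs ↦
    (neg_pos.2 (hφ.metricRep_neg hφ.isTHOCKV (hφ.mem_target hs h0))).ne'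

/-- The function `√(-g(ξ, ξ))` is smooth on the slice `s = 0`. -/
theorem contDiffOn_sqrt_slice (hφ : IsConformalChart g φ ξ κ ε) :
    ContDiffOn ℝ ∞ (fun q ↦ √(-g.metricRep φ ((0 : ℝ), q) (1, 0) (1, 0))) (Metric.ball 0 ε) := by
  have h0 : (0 : ℝ) ∈ Metric.ball (0 : ℝ) ε := Metric.mem_ball_self hφ.pos
  have h : ContDiffOn ℝ ∞ (fun q : Space n ↦ g.metricRep φ (0, q)) (Metric.ball 0 ε) :=
    (hφ.isSmoothChart.contDiffOn_metricRep g).comp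
      (contDiff_prodMk_right (0 : ℝ)).contDiffOn fun q hq ↦ hφ.mem_target h0 hq
  exact ((h.clm_apply contDiffOn_const).clm_apply contDiffOn_const).neg.sqrt fun q hq ↦
    (neg_pos.2 (hφ.metricRep_neg hφ.isTHOCKV (hφ.mem_target h0 hq))).ne'

/-- If the length of `ξ` separates, the spacetime is doubly warped near each point. -/
theorem exists_doublyWarpedOn (hφ : IsConformalChart g φ ξ κ ε) {p : M} (hp : p ∈ φ.source)
    (hsep : ∀ s ∈ Metric.ball (0 : ℝ) ε, ∀ q ∈ Metric.ball (0 : Space n) ε,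
      g.metricRep φ (s, q) (1, 0) (1, 0) * g.metricRep φ (0, 0) (1, 0) (1, 0)
        = g.metricRep φ (0, q) (1, 0) (1, 0) * g.metricRep φ (s, 0) (1, 0) (1, 0)) :
    ∃ U : Set M, IsOpen U ∧ p ∈ U ∧ g.DoublyWarpedOn U := by
  have h0 : (0 : ℝ) ∈ Metric.ball (0 : ℝ) ε := Metric.mem_ball_self hφ.pos
  have h0' : (0 : Space n) ∈ Metric.ball (0 : Space n) ε := Metric.mem_ball_self hφ.pos
  have hneg : ∀ s ∈ Metric.ball (0 : ℝ) ε, ∀ q ∈ Metric.ball (0 : Space n) ε,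
      0 < -g.metricRep φ (s, q) (1, 0) (1, 0) := fun s hs q hq ↦
    neg_pos.2 (hφ.metricRep_neg hφ.isTHOCKV (hφ.mem_target hs hq))
  -- With `N = g(ξ, ξ)`, the factors are `A(s) = √(-N(s, 0))` and `B(q) = √(-N(0, q)) / √(-N(0,
  -- 0))`; separation says exactly that `A² B² = -N`.
  obtain ⟨φ', a, gs, hpφ, -, hw⟩ := hφ.exists_isDoublyWarpedChart hp hφ.contDiffOn_sqrt_axis
    (fun s hs ↦ Real.sqrt_pos.2 (hneg s hs 0 h0'))
    (hφ.contDiffOn_sqrt_slice.div_const √(-g.metricRep φ ((0 : ℝ), (0 : Space n)) (1, 0) (1, 0)))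
    (fun q hq ↦ div_pos (Real.sqrt_pos.2 (hneg 0 h0 q hq)) (Real.sqrt_pos.2 (hneg 0 h0 0 h0')))
    (fun s hs q hq ↦ by
      rw [div_pow, Real.sq_sqrt (hneg s hs 0 h0').le, Real.sq_sqrt (hneg 0 h0 q hq).le,
        Real.sq_sqrt (hneg 0 h0 0 h0').le]
      have h1 : g.metricRep φ (0, (0 : Space n)) (1, 0) (1, 0) ≠ 0 :=
        (neg_pos.1 (hneg 0 h0 0 h0')).ne
      have h2 := hsep s hs q hq
      rw [← mul_right_cancel_iff_of_pos (hneg 0 h0 0 h0')]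
      field_simp
      linarith)
  exact ⟨φ'.source, φ'.open_source, hpφ, φ', a, _, gs, rfl, hw⟩

end IsConformalChart

end ConformalCharts

/-! ### The local characterisations and the warped case -/

namespace LorentzianMetric

variable {n : ℕ} {M : Type*} [TopologicalSpace M] [ChartedSpace (Model n) M]
  [IsManifold (𝓡 (n + 1)) ∞ M] {g : LorentzianMetric n M} {ξ : VField n M} {κ : M → ℝ} {U : Set M}

theorem HasClosedTHOCKV.exists_doublyWarpedOn (h : g.HasClosedTHOCKV U) {p : M} (hp : p ∈ U) :
    ∃ V : Set M, IsOpen V ∧ p ∈ V ∧ g.DoublyWarpedOn V := by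
  obtain ⟨ξ, κ, α, hξ, hα, hcl⟩ := h
  obtain ⟨φ, ε, hφ, hpφ, hφU⟩ := exists_isConformalChart hξ hp
  exact hφ.exists_doublyWarpedOn hpφ fun s hs q hq ↦ hφ.metricRep_of_associatedForm_closed
    ⟨hα.1.mono hφU, fun p hp ↦ hα.2.1 p (hφU hp), fun p hp ↦ hα.2.2 p (hφU hp)⟩
    (fun p hp ↦ hcl p (hφU hp)) hs hq

theorem HasParallelTHOCKV.exists_doublyWarpedOn (h : g.HasParallelTHOCKV U) {p : M} (hp : p ∈ U) :
    ∃ V : Set M, IsOpen V ∧ p ∈ V ∧ g.DoublyWarpedOn V := by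
  obtain ⟨ξ, κ, hξ, hpar⟩ := h
  obtain ⟨φ, ε, hφ, hpφ, hφU⟩ := exists_isConformalChart hξ hp
  exact hφ.exists_doublyWarpedOn hpφ fun s hs q hq ↦
    hφ.metricRep_of_parallel (fun p hp ↦ hpar p (hφU hp)) hs hq

/-- Closedness makes `g(ξ, ξ)` a function of `s` alone, so the separation holds with `B = 1`. -/
theorem IsTHOCKV.exists_warpedOn (h : g.IsTHOCKV ξ κ U) (hcl : ClosedOn (g.flat ξ) U) {p : M}
    (hp : p ∈ U) : ∃ V : Set M, IsOpen V ∧ p ∈ V ∧ V ⊆ U ∧ g.WarpedOn V := by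
  obtain ⟨φ, ε, hφ, hpφ, hφU⟩ := exists_isConformalChart h hp
  have h0' : (0 : Space n) ∈ Metric.ball (0 : Space n) ε := Metric.mem_ball_self hφ.pos
  have hneg : ∀ s ∈ Metric.ball (0 : ℝ) ε, 0 < -g.metricRep φ (s, (0 : Space n)) (1, 0) (1, 0) :=
    fun s hs ↦ neg_pos.2 (hφ.metricRep_neg hφ.isTHOCKV (hφ.mem_target hs h0'))
  obtain ⟨φ', a, gs, hpφ', hsub, hw⟩ := hφ.exists_isDoublyWarpedChart hpφ hφ.contDiffOn_sqrt_axis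
    (fun s hs ↦ Real.sqrt_pos.2 (hneg s hs)) (B := fun _ ↦ 1) contDiffOn_const
    (fun _ _ ↦ one_pos) (fun s hs q hq ↦ by
      rw [Real.sq_sqrt (hneg s hs).le, hφ.metricRep_of_closed (fun p hp ↦ hcl p (hφU hp)) hs hq]
      ring)
  exact ⟨φ'.source, φ'.open_source, hpφ', hsub.trans hφU, φ', a, gs, rfl, hw⟩

/-- If `ξ_i` is closed, its associated 1-form vanishes. -/
theorem IsTHOCKV.associatedFormOn_zero (h : g.IsTHOCKV ξ κ U) (hcl : ClosedOn (g.flat ξ) U) :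
    g.AssociatedFormOn ξ κ (fun _ ↦ 0) U := by
  refine ⟨smoothFormOn_zero U, fun _ _ ↦ rfl, fun p hp X Y hX hY ↦ ?_⟩
  have h1 := h.conformalKilling.2.2 p hp X Y hX hY
  -- The antisymmetric part of `∇ξ` is half of `dξ♭ = 0`, so only the conformal part remains.
  have h2 := g.nabla_sub_swap ξ X Y p
  rw [hcl p hp X Y hX hY] at h2
  simp only [zero_apply, zero_mul, mul_zero, add_zero, sub_zero]
  linarith

end LorentzianMetric

end DoublyWarped

end

theorem mainTheorem7 {n : ℕ} {M : Type*} [TopologicalSpace M] [T2Space M]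
    [SecondCountableTopology M] [ChartedSpace (DoublyWarped.Model n) M]
    [IsManifold (𝓡 (n + 1)) ∞ M] (g : DoublyWarped.LorentzianMetric n M) :
    -- doubly warped iff there is such a vector with closed associated form
    (∀ p : M, (∃ U : Set M, IsOpen U ∧ p ∈ U ∧ g.DoublyWarpedOn U) ↔
      ∃ U : Set M, IsOpen U ∧ p ∈ U ∧ g.HasClosedTHOCKV U) ∧
    -- doubly warped iff there is such a vector with the gradient of `κ` parallel to it
    (∀ p : M, (∃ U : Set M, IsOpen U ∧ p ∈ U ∧ g.DoublyWarpedOn U) ↔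
      ∃ U : Set M, IsOpen U ∧ p ∈ U ∧ g.HasParallelTHOCKV U) ∧
    -- the vector exists on the whole domain of doubly warped coordinates
    (∀ U : Set M, IsOpen U → g.DoublyWarpedOn U →
      g.HasClosedTHOCKV U ∧ g.HasParallelTHOCKV U) ∧
    -- if the vector is closed, the associated form vanishes and the spacetime is warped
    (∀ (U : Set M) (ξ : DoublyWarped.VField n M) (κ : M → ℝ), IsOpen U →
      g.IsTHOCKV ξ κ U → DoublyWarped.ClosedOn (g.flat ξ) U →
      g.AssociatedFormOn ξ κ (fun _ ↦ 0) U ∧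
      ∀ p ∈ U, ∃ V : Set M, IsOpen V ∧ p ∈ V ∧ V ⊆ U ∧ g.WarpedOn V) := by
  refine ⟨fun p ↦ ⟨fun ⟨U, hU, hp, h⟩ ↦ ⟨U, hU, hp, h.hasClosedTHOCKV⟩,
    fun ⟨_, _, hp, h⟩ ↦ h.exists_doublyWarpedOn hp⟩,
    fun p ↦ ⟨fun ⟨U, hU, hp, h⟩ ↦ ⟨U, hU, hp, h.hasParallelTHOCKV⟩,
    fun ⟨_, _, hp, h⟩ ↦ h.exists_doublyWarpedOn hp⟩,
    fun U _ h ↦ ⟨h.hasClosedTHOCKV, h.hasParallelTHOCKV⟩,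
    fun U ξ κ _ h hcl ↦ ⟨h.associatedFormOn_zero hcl, fun p hp ↦ h.exists_warpedOn hcl hp⟩⟩
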